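/- For a $C^k$ function $g$ on an interval $I\subset\mathbb R$ write $\|g\|_k=\sup\{|D^m g(x)| : 0\le m\le k,\ x\in I\}\in[0,+\infty]$ (one-sided derivatives at an endpoint belonging to $I$). If $f$ is a $C^r$ diffeomorphism of $[a,b)$ onto itself, $2\le r\le\infty$, whose only fixed point is $a$, its Szekeres vector field $\nu$ is the $C^1$ vector field on $[a,b)$ (identified with a function) whose time-$1$ map exists and equals $f$; such a vector field exists, is unique and has a complete flow $(f^t)_{t\in\mathbb R}$ of $C^1$ maps of $[a,b)$, with $f^0=\mathrm{id}$ and $f^1=f$. There exist continuous functions $u,v:[0,1)\to\mathbb R$ with $u(0)=v(0)=0$ such that the following holds for all $0\le a<b\le 1$, all $2\le r\le\infty$, every $C^r$ diffeomorphism $f$ of $[a,b)$ fixing only $a$, and every $\delta<1$ with $\|f-\mathrm{id}\|_2<\delta$ (norm over $[a,b)$). The Szekeres vector field $\nu$ of $f$ satisfies $\nu/(f-\mathrm{id})>0$ on $(a,b)$, $$\sup_{(a,b)}\left|\log\frac{\nu}{f-\mathrm{id}}\right|<u(\delta)\qquad\text{and}\qquad \sup_{[a,b)}|D\nu|<u(\delta),$$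 and its flow satisfies $$\|f^t-\mathrm{id}\|_1< t\,v(\delta)\quad\text{for all } t\in(0,1]$$ (for $t=0$ both sides are $0$). -/

import Mathlib

open Set
open scoped ENNReal

namespace Szekeres

/-- `f` restricts to a `C^r` diffeomorphism of `I ⊆ ℝ` onto itself (derivatives are taken
within `I`, hence one-sided at an endpoint that belongs to `I`). Values of `f` off `I` are
irrelevant. -/
def IsDiffeoOn (r : ℕ∞) (I : Set ℝ) (f : ℝ → ℝ) : Prop :=
  MapsTo f I I ∧ ContDiffOn ℝ r f I ∧
    ∃ g : ℝ → ℝ, MapsTo g I I ∧ ContDiffOn ℝ r g I ∧ InvOn g f I I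

/-- The norm `sup {|D^m g (x)| : 0 ≤ m ≤ k, x ∈ I} ∈ [0, +∞]` of a `C^k` function `g` on `I`. -/
noncomputable def ckNorm (k : ℕ) (I : Set ℝ) (g : ℝ → ℝ) : ℝ≥0∞ :=
  ⨆ m ∈ Iic k, ⨆ x ∈ I, ‖iteratedDerivWithin m g I x‖ₑ

/-- The time-`1` map of the vector field `ν` on `I` exists and equals `f`: from every point of `I`
there starts an integral curve of `ν` that stays in `I` during `[0, 1]` and ends at its image
under `f`. -/
def HasTimeOneMap (I : Set ℝ) (ν f : ℝ → ℝ) : Prop :=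
  ∀ x ∈ I, ∃ γ : ℝ → ℝ, γ 0 = x ∧ MapsTo γ (Icc 0 1) I ∧
    IsIntegralCurveOn γ (fun _ => ν) (Icc 0 1) ∧ γ 1 = f x

/-- `ν` is a Szekeres vector field of `f` on `[a, b)`: it is of class `C^1` on `[a, b)`, and its
time-`1` map exists and equals `f`. -/
def IsSzekeresField (a b : ℝ) (f ν : ℝ → ℝ) : Prop :=
  ContDiffOn ℝ 1 ν (Ico a b) ∧ HasTimeOneMap (Ico a b) ν f

/-- `φ` is the (complete) flow of the vector field `ν` on `I`, with `φ t` the time-`t` map. -/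
def IsFlowOn (I : Set ℝ) (ν : ℝ → ℝ) (φ : ℝ → ℝ → ℝ) : Prop :=
  ∀ x ∈ I, φ 0 x = x ∧ (∀ t, φ t x ∈ I) ∧ IsIntegralCurve (fun t => φ t x) (fun _ => ν)

end Szekeres

namespace Szekeres

open Filter Topology

/-! ### One-variable calculus on a half-open interval -/

/-! Suppose first that `g x < x` off `a`, and write `Δ = g - id`. A field is `g`-invariant when it
equals its pullback `X ∘ g / g'`. Pulling `Δ` back once multiplies it by the exponential of the
defect, which by the mean value theorem is `log g'(c) - log g'(x)` with `c` between `g x` and `x`.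
It is therefore at most `K (x - g x)`, where `K` bounds `|g''| / g'`. Displacements telescope along
an orbit, so the defects sum to at most `K (x - a) ≤ K`, and the iterated pullbacks converge to the
invariant field `invField`, whose ratio to `Δ` lies between `exp (-K)` and `exp K`. The derivatives
of the pullbacks obey an affine recursion of the same telescoping kind and converge uniformly near
`a` (`abs_pullbackDeriv_sub_le`), so the limit is `C^1` up to `a`.

If `T` is a primitive of the inverse of that field, invariance makes `T ∘ g - T` a constant `τ`.
Multiplying the field by `τ` turns the constant into `1`, which is Abel's equation; `τ` is
controlled by distortion on one fundamental interval `[g x, x]` (`exists_abelPair`). Uniqueness is a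
Kopell-type argument: two invariant `C^1` fields are proportional on a fundamental interval because
both are `C^1` at `a` (`eq_zero_of_invariant`), and Abel's equation fixes the factor.

The flow is `T⁻¹ (T x + t)`. Its space derivative is `ν (φ t x) / ν x = exp (t ν' (φ s x))` for some
`s`, so the bound on `ν'` controls it. Conversely every Szekeres field has an Abel function
(`IsSzekeresField.exists_abelPair`), so all statements reduce to Abel pairs. When `f x > x` off `a`,
the argument is applied to the inverse of `f` and time is reversed. -/

lemma hasDerivAt_of_mem_Ioo {a b : ℝ} {F : ℝ → ℝ} {y x : ℝ} (hx : x ∈ Ioo a b)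
    (h : HasDerivWithinAt F y (Ico a b) x) : HasDerivAt F y x :=
  h.hasDerivAt (Ico_mem_nhds hx.1 hx.2)

/-- Mean value theorem for functions differentiable within `[a, b)`. -/
lemma exists_deriv_mul_eq_sub {a b : ℝ} {F F' : ℝ → ℝ}
    (h : ∀ x ∈ Ico a b, HasDerivWithinAt F (F' x) (Ico a b) x) {x y : ℝ}
    (hx : a ≤ x) (hxy : x < y) (hy : y < b) :
    ∃ c ∈ Ioo x y, F y - F x = F' c * (y - x) := by
  have hsub : Icc x y ⊆ Ico a b := fun z hz => ⟨hx.trans hz.1, hz.2.trans_lt hy⟩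
  obtain ⟨c, hc, e⟩ := exists_hasDerivAt_eq_slope F F' hxy
    (fun z hz => (h z (hsub hz)).continuousWithinAt.mono hsub)
    (fun z hz => hasDerivAt_of_mem_Ioo ⟨hx.trans_lt hz.1, hz.2.trans hy⟩
      (h z (hsub (Ioo_subset_Icc_self hz))))
  refine ⟨c, hc, ?_⟩
  rw [e, div_mul_cancel₀ _ (sub_pos.2 hxy).ne']

/-- Mean value theorem for functions differentiable on `(a, b)`. -/
lemma exists_deriv_mul_eq_sub_of_Ioo {a b : ℝ} {F F' : ℝ → ℝ}
    (h : ∀ x ∈ Ioo a b, HasDerivAt F (F' x) x) {x y : ℝ}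
    (hx : a < x) (hxy : x < y) (hy : y < b) :
    ∃ c ∈ Ioo x y, F y - F x = F' c * (y - x) :=
  exists_deriv_mul_eq_sub (a := x)
    (fun z hz => (h z ⟨hx.trans_le hz.1, hz.2⟩).hasDerivWithinAt) le_rfl hxy hy

lemma abs_sub_le_of_abs_deriv_le {a b C : ℝ} {F F' : ℝ → ℝ}
    (h : ∀ x ∈ Ico a b, HasDerivWithinAt F (F' x) (Ico a b) x)
    {x y : ℝ} (hx : a ≤ x) (hxy : x ≤ y) (hy : y < b) (hC : ∀ z ∈ Ioo x y, |F' z| ≤ C) :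
    |F y - F x| ≤ C * (y - x) := by
  rcases hxy.eq_or_lt with rfl | hlt
  · simp
  · obtain ⟨c, hc, e⟩ := exists_deriv_mul_eq_sub h hx hlt hy
    rw [e, abs_mul, abs_of_pos (sub_pos.2 hlt)]
    exact mul_le_mul_of_nonneg_right (hC c hc) (sub_pos.2 hlt).le

/-- A function that is continuous on `[a, b)` and whose derivative on `(a, b)` extends continuously
to `a` is differentiable at `a`. -/
lemma hasDerivWithinAt_left_endpoint {a b : ℝ} {F F' : ℝ → ℝ} (hab : a < b)
    (h : ∀ x ∈ Ioo a b, HasDerivAt F (F' x) x) (hF : ContinuousWithinAt F (Ico a b) a)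
    (hF' : Tendsto F' (𝓝[>] a) (𝓝 (F' a))) : HasDerivWithinAt F (F' a) (Ico a b) a := by
  have hI : Ioo a b ∈ 𝓝[>] a := Ioo_mem_nhdsGT hab
  refine (hasDerivWithinAt_Ici_of_tendsto_deriv (s := Ioo a b)
    (fun x hx => (h x hx).differentiableAt.differentiableWithinAt)
    (hF.mono Ioo_subset_Ico_self) hI (hF'.congr' ?_)).mono Ico_subset_Ici_self
  filter_upwards [hI] with x hx using (h x hx).deriv.symm

lemma exists_primitive_on_Ioo {a b : ℝ} {h : ℝ → ℝ} (hab : a < b) (hc : ContinuousOn h (Ioo a b)) :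
    ∃ T : ℝ → ℝ, ∀ x ∈ Ioo a b, HasDerivAt T (h x) x := by
  obtain ⟨m, hm⟩ := exists_between hab
  refine ⟨fun x => ∫ t in m..x, h t, fun x hx => ?_⟩
  have hsub : uIcc m x ⊆ Ioo a b := by
    intro z hz
    exact (convex_Ioo a b).ordConnected.uIcc_subset hm hx hz
  refine intervalIntegral.integral_hasDerivAt_right ((hc.mono hsub).intervalIntegrable)
    ?_ (hc.continuousAt (Ioo_mem_nhds hx.1 hx.2))
  exact hc.stronglyMeasurableAtFilter isOpen_Ioo x hx

lemma abs_exp_sub_one_le_abs_mul_exp (y : ℝ) : |Real.exp y - 1| ≤ |y| * Real.exp |y| := by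
  rcases le_total 0 y with h | h
  · rw [abs_of_nonneg (by linarith [Real.add_one_le_exp y]), abs_of_nonneg h]
    have h1 := mul_le_mul_of_nonneg_right (Real.add_one_le_exp (-y)) (Real.exp_pos y).le
    rw [← Real.exp_add] at h1
    simp at h1
    linarith
  · rw [abs_of_nonpos (by linarith [Real.exp_le_one_iff.2 h]), abs_of_nonpos h]
    have h1 := Real.add_one_le_exp y
    have h2 : 1 ≤ Real.exp (-y) := Real.one_le_exp (by linarith)
    nlinarith

lemma abs_log_le_iff {x B : ℝ} (hx : 0 < x) :
    |Real.log x| ≤ B ↔ Real.exp (-B) ≤ x ∧ x ≤ Real.exp B := by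
  rw [abs_le, Real.le_log_iff_exp_le hx, Real.log_le_iff_le_exp hx]

/-! ### Contractions of a half-open interval -/

/-- `g` is a `C^2` diffeomorphism of `[a, b)` with `g x < x` on `(a, b)`, with first and second
derivatives `g'` and `g''` and with quantitative bounds on them. -/
structure IsContraction (a b K L η : ℝ) (g g' g'' : ℝ → ℝ) : Prop where
  lt : a < b
  sub_le : b - a ≤ 1
  bijOn : BijOn g (Ico a b) (Ico a b)
  map_left : g a = a
  map_lt : ∀ x ∈ Ioo a b, g x < x
  deriv : ∀ x ∈ Ico a b, HasDerivWithinAt g (g' x) (Ico a b) x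
  deriv2 : ∀ x ∈ Ico a b, HasDerivWithinAt g' (g'' x) (Ico a b) x
  cont : ContinuousOn g'' (Ico a b)
  exp_le : ∀ x ∈ Ico a b, Real.exp (-L) ≤ g' x
  le_exp : ∀ x ∈ Ico a b, g' x ≤ Real.exp L
  abs_sub_one_le : ∀ x ∈ Ico a b, |g' x - 1| ≤ η
  abs_deriv2_le : ∀ x ∈ Ico a b, |g'' x| ≤ K * g' x

namespace IsContraction

variable {a b K L η : ℝ} {g g' g'' : ℝ → ℝ}

lemma left_mem (h : IsContraction a b K L η g g' g'') : a ∈ Ico a b := ⟨le_rfl, h.lt⟩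

lemma deriv_pos (h : IsContraction a b K L η g g' g'') {x : ℝ} (hx : x ∈ Ico a b) : 0 < g' x :=
  (Real.exp_pos _).trans_le (h.exp_le x hx)

lemma K_nonneg (h : IsContraction a b K L η g g' g'') : 0 ≤ K :=
  nonneg_of_mul_nonneg_left ((abs_nonneg _).trans (h.abs_deriv2_le a h.left_mem))
    (h.deriv_pos h.left_mem)

lemma L_nonneg (h : IsContraction a b K L η g g' g'') : 0 ≤ L := by
  have := Real.exp_le_exp.1 ((h.exp_le a h.left_mem).trans (h.le_exp a h.left_mem))
  linarith

lemma le_self (h : IsContraction a b K L η g g' g'') {x : ℝ} (hx : x ∈ Ico a b) : g x ≤ x := by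
  rcases hx.1.eq_or_lt with rfl | h1
  · exact h.map_left.le
  · exact (h.map_lt x ⟨h1, hx.2⟩).le

lemma mapsTo (h : IsContraction a b K L η g g' g'') : MapsTo g (Ico a b) (Ico a b) := h.bijOn.mapsTo

lemma mapsTo_Ioo (h : IsContraction a b K L η g g' g'') : MapsTo g (Ioo a b) (Ioo a b) := by
  intro x hx
  have hx' := Ioo_subset_Ico_self hx
  refine ⟨lt_of_le_of_ne (h.mapsTo hx').1 fun e => ?_, (h.mapsTo hx').2⟩
  exact hx.1.ne (h.bijOn.injOn h.left_mem hx' (h.map_left.trans e))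

lemma iterate_mem (h : IsContraction a b K L η g g' g'') {x : ℝ} (hx : x ∈ Ico a b) (n : ℕ) :
    g^[n] x ∈ Ico a b := h.mapsTo.iterate n hx

lemma iterate_mem_Ioo (h : IsContraction a b K L η g g' g'') {x : ℝ} (hx : x ∈ Ioo a b) (n : ℕ) :
    g^[n] x ∈ Ioo a b := h.mapsTo_Ioo.iterate n hx

lemma continuousOn (h : IsContraction a b K L η g g' g'') : ContinuousOn g (Ico a b) :=
  fun x hx => (h.deriv x hx).continuousWithinAt

lemma monotoneOn (h : IsContraction a b K L η g g' g'') : MonotoneOn g (Ico a b) := by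
  intro x hx y hy hxy
  rcases hxy.eq_or_lt with rfl | hlt
  · exact le_rfl
  · obtain ⟨c, hc, e⟩ := exists_deriv_mul_eq_sub h.deriv hx.1 hlt hy.2
    have := mul_pos (h.deriv_pos (x := c) ⟨hx.1.trans hc.1.le, hc.2.trans hy.2⟩) (sub_pos.2 hlt)
    linarith

lemma iterate_monotoneOn (h : IsContraction a b K L η g g' g'') (n : ℕ) :
    MonotoneOn g^[n] (Ico a b) := by
  induction n with
  | zero => exact monotoneOn_id
  | succ n ih =>
    intro x hx y hy hxy
    exact ih (h.mapsTo hx) (h.mapsTo hy) (h.monotoneOn hx hy hxy)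

lemma tendsto_iterate (h : IsContraction a b K L η g g' g'') {x : ℝ} (hx : x ∈ Ico a b) :
    Tendsto (fun n => g^[n] x) atTop (𝓝 a) := by
  have hanti : Antitone fun n => g^[n] x := antitone_nat_of_succ_le fun n => by
    rw [Function.iterate_succ_apply']
    exact h.le_self (h.iterate_mem hx n)
  have hbdd : BddBelow (range fun n => g^[n] x) :=
    ⟨a, by rintro _ ⟨n, rfl⟩; exact (h.iterate_mem hx n).1⟩
  have hlim := tendsto_atTop_ciInf hanti hbdd
  set l := ⨅ n, g^[n] x with hl
  have hlI : l ∈ Ico a b :=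
    ⟨le_ciInf fun n => (h.iterate_mem hx n).1, (ciInf_le hbdd 0).trans_lt hx.2⟩
  have h1 : Tendsto (fun n => g (g^[n] x)) atTop (𝓝 (g l)) :=
    (h.continuousOn l hlI).tendsto.comp
      (tendsto_nhdsWithin_iff.2 ⟨hlim, Eventually.of_forall fun n => h.iterate_mem hx n⟩)
  have h2 : Tendsto (fun n => g (g^[n] x)) atTop (𝓝 l) := by
    simp only [← Function.iterate_succ_apply']
    exact hlim.comp (tendsto_add_atTop_nat 1)
  have hfix := tendsto_nhds_unique h1 h2
  rcases hlI.1.eq_or_lt with e | hlt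
  · rwa [← e] at hlim
  · exact absurd hfix (h.map_lt l ⟨hlt, hlI.2⟩).ne

/-! Sums along orbits. -/

/-- The sum of the displacements `g^[k] x - g^[k+1] x` telescopes and orbits stay above `a`. Every
series in the construction is controlled this way, including when `g' a = 1` and no geometric decay
is available. -/
lemma orbit_sum_bound (h : IsContraction a b K L η g g' g'') {F : ℝ → ℝ} {C : ℝ}
    (hF : ∀ x ∈ Ico a b, |F x| ≤ C * (x - g x)) (hC : 0 ≤ C) {x : ℝ} (hx : x ∈ Ico a b) (n : ℕ) :
    ∑ k ∈ Finset.range n, |F (g^[k] x)| ≤ C * (x - a) := by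
  have : ∀ k ∈ Finset.range n, |F (g^[k] x)| ≤ C * (g^[k] x - g^[k + 1] x) := fun k _ => by
    rw [Function.iterate_succ_apply']
    exact hF _ (h.iterate_mem hx k)
  refine (Finset.sum_le_sum this).trans ?_
  rw [← Finset.mul_sum, Finset.sum_range_sub']
  exact mul_le_mul_of_nonneg_left (sub_le_sub_left (h.iterate_mem hx n).1 _) hC

lemma orbit_summable (h : IsContraction a b K L η g g' g'') {F : ℝ → ℝ} {C : ℝ}
    (hF : ∀ x ∈ Ico a b, |F x| ≤ C * (x - g x)) (hC : 0 ≤ C) {x : ℝ} (hx : x ∈ Ico a b) :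
    Summable fun n => F (g^[n] x) :=
  (summable_of_sum_range_le (fun _ => abs_nonneg _) (h.orbit_sum_bound hF hC hx)).of_abs

lemma abs_orbit_tsum_le (h : IsContraction a b K L η g g' g'') {F : ℝ → ℝ} {C : ℝ}
    (hF : ∀ x ∈ Ico a b, |F x| ≤ C * (x - g x)) (hC : 0 ≤ C) {x : ℝ} (hx : x ∈ Ico a b) :
    |∑' n, F (g^[n] x)| ≤ C * (x - a) := by
  have hs : Summable fun n => ‖F (g^[n] x)‖ :=
    summable_of_sum_range_le (fun _ => abs_nonneg _) (h.orbit_sum_bound hF hC hx)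
  exact (norm_tsum_le_tsum_norm hs).trans
    (Real.tsum_le_of_sum_range_le (fun _ => abs_nonneg _) (h.orbit_sum_bound hF hC hx))

lemma orbit_tsum_eq (h : IsContraction a b K L η g g' g'') {F : ℝ → ℝ} {C : ℝ}
    (hF : ∀ x ∈ Ico a b, |F x| ≤ C * (x - g x)) (hC : 0 ≤ C) {x : ℝ} (hx : x ∈ Ico a b) :
    ∑' n, F (g^[n] x) = F x + ∑' n, F (g^[n] (g x)) :=
  (h.orbit_summable hF hC hx).tsum_eq_zero_add

/-! Distortion. -/

/-- The displacement varies by a factor at most `exp L` on `[g x, x]`. -/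
lemma displacement_ratio (h : IsContraction a b K L η g g' g'') {x y : ℝ} (hx : x ∈ Ioo a b)
    (hy : y ∈ Icc (g x) x) :
    Real.exp (-L) * (x - g x) ≤ y - g y ∧ y - g y ≤ Real.exp L * (x - g x) := by
  have hpos : 0 < x - g x := sub_pos.2 (h.map_lt x hx)
  have h1 : Real.exp (-L) ≤ 1 := Real.exp_le_one_iff.2 (by linarith [h.L_nonneg])
  have h2 : 1 ≤ Real.exp L := Real.one_le_exp h.L_nonneg
  rcases hy.2.eq_or_lt with rfl | hlt
  · constructor <;> nlinarith
  · have hgx := h.mapsTo_Ioo hx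
    obtain ⟨c, hc, e⟩ := exists_deriv_mul_eq_sub h.deriv (hgx.1.le.trans hy.1) hlt hx.2
    have hcI : c ∈ Ico a b := ⟨(hgx.1.le.trans hy.1).trans hc.1.le, hc.2.trans hx.2⟩
    have h3 := h.exp_le c hcI
    have h4 := h.le_exp c hcI
    have h5 : 0 ≤ y - g x := sub_nonneg.2 hy.1
    have h6 : 0 < x - y := sub_pos.2 hlt
    -- The lengths `y - g x` and `x - y` add up to `x - g x`; only the second is weighted, by a
    -- factor in `[exp (-L), exp L]`.
    have key : y - g y = (y - g x) + g' c * (x - y) := by linarith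
    rw [key]
    constructor <;> nlinarith

lemma abs_log_deriv_sub_le (h : IsContraction a b K L η g g' g'') {x y : ℝ} (hx : a ≤ x)
    (hxy : x ≤ y) (hy : y < b) : |Real.log (g' y) - Real.log (g' x)| ≤ K * (y - x) := by
  refine abs_sub_le_of_abs_deriv_le (F' := fun x => g'' x / g' x)
    (fun z hz => (h.deriv2 z hz).log (h.deriv_pos hz).ne') hx hxy hy fun z hz => ?_
  have hzI : z ∈ Ico a b := ⟨hx.trans hz.1.le, hz.2.trans hy⟩
  rw [abs_div, abs_of_pos (h.deriv_pos hzI), div_le_iff₀ (h.deriv_pos hzI)]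
  exact h.abs_deriv2_le z hzI

end IsContraction

/-! ### The invariant field of a contraction -/

/-- The logarithm of the ratio between the displacement of `g` and its pullback by `g`. -/
noncomputable def defect (g g' : ℝ → ℝ) (x : ℝ) : ℝ :=
  Real.log ((g x - g (g x)) / ((x - g x) * g' x))

/-- The sum of the defects along the orbit of `x`. -/
noncomputable def defectSum (g g' : ℝ → ℝ) (x : ℝ) : ℝ := ∑' n, defect g g' (g^[n] x)

/-- The `g`-invariant field, normalized to be asymptotic to the displacement. -/
noncomputable def invField (g g' : ℝ → ℝ) (x : ℝ) : ℝ :=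
  (g x - x) * Real.exp (defectSum g g' x)

/-- The derivative of `invField`. -/
noncomputable def invFieldDeriv (a : ℝ) (g g' g'' : ℝ → ℝ) (x : ℝ) : ℝ :=
  g' a - 1 - ∑' n, invField g g' (g^[n] x) * (g'' (g^[n] x) / g' (g^[n] x))

/-- The pullbacks of the displacement by the iterates of `g`. -/
noncomputable def pullback (g g' : ℝ → ℝ) : ℕ → ℝ → ℝ
  | 0, x => g x - x
  | n + 1, x => pullback g g' n (g x) / g' x

/-- The derivatives of the pullbacks. -/
noncomputable def pullbackDeriv (g g' g'' : ℝ → ℝ) : ℕ → ℝ → ℝ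
  | 0, x => g' x - 1
  | n + 1, x => pullbackDeriv g g' g'' n (g x) - pullback g g' (n + 1) x * (g'' x / g' x)

namespace IsContraction

variable {a b K L η : ℝ} {g g' g'' : ℝ → ℝ}

lemma abs_log_ratio_le (h : IsContraction a b K L η g g' g'') {x : ℝ} (hx : x ∈ Ico a b) :
    |g'' x / g' x| ≤ K := by
  rw [abs_div, abs_of_pos (h.deriv_pos hx), div_le_iff₀ (h.deriv_pos hx)]
  exact h.abs_deriv2_le x hx

/-- The quotient of successive displacements is `g' c` for some `c` in `(g x, x)`, so the defect is
a variation of `log g'` over an interval inside `[g x, x]`. -/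
lemma abs_defect_le (h : IsContraction a b K L η g g' g'') {x : ℝ} (hx : x ∈ Ico a b) :
    |defect g g' x| ≤ K * (x - g x) := by
  rcases hx.1.eq_or_lt with rfl | hlt
  -- At `a` the quotient is `0 / 0 = 0` and `Real.log 0 = 0`.
  · simp [defect, h.map_left]
  · have hlt' := h.map_lt x ⟨hlt, hx.2⟩
    have hgx := h.mapsTo hx
    obtain ⟨c, hc, e⟩ := exists_deriv_mul_eq_sub h.deriv hgx.1 hlt' hx.2
    have hcI : c ∈ Ico a b := ⟨hgx.1.trans hc.1.le, hc.2.trans hx.2⟩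
    have h1 : defect g g' x = Real.log (g' c) - Real.log (g' x) := by
      rw [defect, e, mul_comm (g' c), mul_div_mul_left _ _ (sub_pos.2 hlt').ne',
        Real.log_div (h.deriv_pos hcI).ne' (h.deriv_pos hx).ne']
    rw [h1, abs_sub_comm]
    exact (h.abs_log_deriv_sub_le hcI.1 hc.2.le hx.2).trans
      (mul_le_mul_of_nonneg_left (sub_le_sub_left hc.1.le _) h.K_nonneg)

lemma abs_defectSum_le_mul (h : IsContraction a b K L η g g' g'') {x : ℝ} (hx : x ∈ Ico a b) :
    |defectSum g g' x| ≤ K * (x - a) :=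
  h.abs_orbit_tsum_le (fun _ => h.abs_defect_le) h.K_nonneg hx

lemma abs_defectSum_le (h : IsContraction a b K L η g g' g'') {x : ℝ} (hx : x ∈ Ico a b) :
    |defectSum g g' x| ≤ K := by
  have h1 := h.abs_defectSum_le_mul hx
  have h2 : x - a ≤ 1 := by linarith [h.sub_le, hx.2]
  have := h.K_nonneg
  nlinarith

lemma defectSum_eq (h : IsContraction a b K L η g g' g'') {x : ℝ} (hx : x ∈ Ico a b) :
    defectSum g g' x = defect g g' x + defectSum g g' (g x) :=
  h.orbit_tsum_eq (fun _ => h.abs_defect_le) h.K_nonneg hx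

lemma exp_defect (h : IsContraction a b K L η g g' g'') {x : ℝ} (hx : x ∈ Ioo a b) :
    (g x - x) * Real.exp (defect g g' x) = (g (g x) - g x) / g' x := by
  have h1 := sub_pos.2 (h.map_lt x hx)
  have h2 := sub_pos.2 (h.map_lt _ (h.mapsTo_Ioo hx))
  have h3 := h.deriv_pos (Ioo_subset_Ico_self hx)
  rw [defect, Real.exp_log (by positivity)]
  have := h1.ne'
  field_simp
  ring

lemma pullback_left (h : IsContraction a b K L η g g' g'') (n : ℕ) : pullback g g' n a = 0 := by
  induction n with
  | zero => simp [pullback, h.map_left]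
  | succ n ih => simp [pullback, h.map_left, ih]

/-- Each pullback contributes one factor `exp (defect)`, so the `n`-th one carries a partial sum of
the series, written as a difference of two full sums. -/
lemma pullback_eq (h : IsContraction a b K L η g g' g'') (n : ℕ) {x : ℝ} (hx : x ∈ Ico a b) :
    pullback g g' n x = (g x - x) * Real.exp (defectSum g g' x - defectSum g g' (g^[n] x)) := by
  rcases hx.1.eq_or_lt with rfl | hlt
  · simp [h.pullback_left, h.map_left]
  induction n generalizing x with
  | zero => simp [pullback]
  | succ n ih =>
    have hxo : x ∈ Ioo a b := ⟨hlt, hx.2⟩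
    rw [pullback, ih (h.mapsTo hx) (h.mapsTo_Ioo hxo).1, h.defectSum_eq hx,
      Function.iterate_succ_apply, add_sub_assoc, Real.exp_add, ← mul_assoc, h.exp_defect hxo]
    ring

lemma hasDerivWithinAt_pullback (h : IsContraction a b K L η g g' g'') (n : ℕ) :
    ∀ x ∈ Ico a b, HasDerivWithinAt (pullback g g' n) (pullbackDeriv g g' g'' n x) (Ico a b) x := by
  induction n with
  | zero => exact fun x hx => (h.deriv x hx).sub (hasDerivWithinAt_id x _)
  | succ n ih =>
    intro x hx
    have h1 := ((ih (g x) (h.mapsTo hx)).comp x (h.deriv x hx) h.mapsTo).div (h.deriv2 x hx)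
      (h.deriv_pos hx).ne'
    refine h1.congr_deriv ?_
    have := (h.deriv_pos hx).ne'
    simp only [pullbackDeriv, pullback, Function.comp]
    field_simp

lemma continuousOn_deriv (h : IsContraction a b K L η g g' g'') : ContinuousOn g' (Ico a b) :=
  fun x hx => (h.deriv2 x hx).continuousWithinAt

lemma continuousOn_pullbackDeriv (h : IsContraction a b K L η g g' g'') (n : ℕ) :
    ContinuousOn (pullbackDeriv g g' g'' n) (Ico a b) := by
  induction n with
  | zero => exact h.continuousOn_deriv.sub continuousOn_const
  | succ n ih =>
    refine (ih.comp h.continuousOn h.mapsTo).sub (ContinuousOn.mul ?_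
      (h.cont.div h.continuousOn_deriv fun x hx => (h.deriv_pos hx).ne'))
    exact fun x hx => (h.hasDerivWithinAt_pullback (n + 1) x hx).continuousWithinAt

lemma invField_left (h : IsContraction a b K L η g g' g'') : invField g g' a = 0 := by
  simp [invField, h.map_left]

lemma invField_neg (h : IsContraction a b K L η g g' g'') {x : ℝ} (hx : x ∈ Ioo a b) :
    invField g g' x < 0 :=
  mul_neg_of_neg_of_pos (sub_neg.2 (h.map_lt x hx)) (Real.exp_pos _)

/-- Dropping the first defect of the orbit is exactly what one pullback of the displacement costs.
-/
lemma invField_map (h : IsContraction a b K L η g g' g'') {x : ℝ} (hx : x ∈ Ioo a b) :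
    invField g g' (g x) = g' x * invField g g' x := by
  have hxI := Ioo_subset_Ico_self hx
  have h1 := h.exp_defect hx
  have := (h.deriv_pos hxI).ne'
  rw [invField, invField, h.defectSum_eq hxI, Real.exp_add, ← mul_assoc (g x - x), h1]
  field_simp

lemma abs_invField_le (h : IsContraction a b K L η g g' g'') {x : ℝ} (hx : x ∈ Ico a b) :
    |invField g g' x| ≤ Real.exp K * (x - g x) := by
  rw [invField, abs_mul, abs_sub_comm, abs_of_nonneg (sub_nonneg.2 (h.le_self hx)),
    abs_of_pos (Real.exp_pos _), mul_comm]
  exact mul_le_mul_of_nonneg_right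
    (Real.exp_le_exp.2 ((le_abs_self _).trans (h.abs_defectSum_le hx)))
    (sub_nonneg.2 (h.le_self hx))

lemma abs_pullback_sub_le (h : IsContraction a b K L η g g' g'') (n : ℕ) {x : ℝ}
    (hx : x ∈ Ico a b) :
    |pullback g g' n x - invField g g' x| ≤
      Real.exp K * (K * Real.exp K) * (x - g x) * (g^[n] x - a) := by
  have hn := h.iterate_mem hx n
  have h1 : pullback g g' n x - invField g g' x =
      invField g g' x * (Real.exp (-defectSum g g' (g^[n] x)) - 1) := by
    rw [h.pullback_eq n hx, invField, sub_eq_add_neg (defectSum g g' x), Real.exp_add]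
    ring
  have h2 := abs_exp_sub_one_le_abs_mul_exp (-defectSum g g' (g^[n] x))
  rw [abs_neg] at h2
  have h3 : |defectSum g g' (g^[n] x)| * Real.exp |defectSum g g' (g^[n] x)| ≤
      K * (g^[n] x - a) * Real.exp K :=
    mul_le_mul (h.abs_defectSum_le_mul hn) (Real.exp_le_exp.2 (h.abs_defectSum_le hn))
      (Real.exp_pos _).le (mul_nonneg h.K_nonneg (sub_nonneg.2 hn.1))
  rw [h1, abs_mul]
  refine (mul_le_mul (h.abs_invField_le hx) (h2.trans h3) (abs_nonneg _)
    (mul_nonneg (Real.exp_pos _).le (sub_nonneg.2 (h.le_self hx)))).trans_eq ?_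
  ring

lemma abs_invField_mul_le (h : IsContraction a b K L η g g' g'') {x : ℝ} (hx : x ∈ Ico a b) :
    |invField g g' x * (g'' x / g' x)| ≤ K * Real.exp K * (x - g x) := by
  rw [abs_mul]
  refine (mul_le_mul (h.abs_invField_le hx) (h.abs_log_ratio_le hx) (abs_nonneg _)
    (mul_nonneg (Real.exp_pos _).le (sub_nonneg.2 (h.le_self hx)))).trans_eq ?_
  ring

lemma K_mul_exp_nonneg (h : IsContraction a b K L η g g' g'') : 0 ≤ K * Real.exp K :=
  mul_nonneg h.K_nonneg (Real.exp_pos _).le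

lemma invFieldDeriv_eq (h : IsContraction a b K L η g g' g'') {x : ℝ} (hx : x ∈ Ico a b) :
    invFieldDeriv a g g' g'' x =
      invFieldDeriv a g g' g'' (g x) - invField g g' x * (g'' x / g' x) := by
  have := h.orbit_tsum_eq (F := fun x => invField g g' x * (g'' x / g' x))
    (fun _ => h.abs_invField_mul_le) h.K_mul_exp_nonneg hx
  rw [invFieldDeriv, this, invFieldDeriv]
  ring

lemma abs_invFieldDeriv_le (h : IsContraction a b K L η g g' g'') {x : ℝ} (hx : x ∈ Ico a b) :
    |invFieldDeriv a g g' g'' x| ≤ η + K * Real.exp K := by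
  have h1 := h.abs_orbit_tsum_le (F := fun x => invField g g' x * (g'' x / g' x))
    (fun _ => h.abs_invField_mul_le) h.K_mul_exp_nonneg hx
  have h2 : x - a ≤ 1 := by linarith [h.sub_le, hx.2]
  refine (abs_sub _ _).trans (add_le_add (h.abs_sub_one_le a h.left_mem) (h1.trans ?_))
  exact mul_le_of_le_one_right h.K_mul_exp_nonneg h2

/-- Both sequences satisfy the same recursion under `x ↦ g x`, up to an error proportional to `(x -
g x) * (g^[n+1] x - a)`. Through the induction the first factors telescope to `x - g^[n] x`, while
the second always refers to the same last point of the orbit; this is why the estimate tends to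
zero. -/
lemma abs_pullbackDeriv_sub_le (h : IsContraction a b K L η g g' g'') (n : ℕ) {x : ℝ}
    (hx : x ∈ Ico a b) :
    |pullbackDeriv g g' g'' n x - invFieldDeriv a g g' g'' x| ≤
      (K * Real.exp L + K * Real.exp K + Real.exp K * (K * Real.exp K) * K * (x - g^[n] x)) *
        (g^[n] x - a) := by
  induction n generalizing x with
  | zero =>
    have h1 := h.abs_orbit_tsum_le (F := fun x => invField g g' x * (g'' x / g' x))
      (fun _ => h.abs_invField_mul_le) h.K_mul_exp_nonneg hx
    have h2 : |g' x - g' a| ≤ K * Real.exp L * (x - a) := by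
      refine abs_sub_le_of_abs_deriv_le h.deriv2 le_rfl hx.1 hx.2 fun z hz => ?_
      have hzI : z ∈ Ico a b := ⟨hz.1.le, hz.2.trans hx.2⟩
      exact (h.abs_deriv2_le z hzI).trans
        (mul_le_mul_of_nonneg_left (h.le_exp z hzI) h.K_nonneg)
    have h3 : pullbackDeriv g g' g'' 0 x - invFieldDeriv a g g' g'' x =
      (g' x - g' a) + ∑' n, invField g g' (g^[n] x) * (g'' (g^[n] x) / g' (g^[n] x)) := by
      simp only [pullbackDeriv, invFieldDeriv]
      ring
    rw [h3]
    refine (abs_add_le _ _).trans ((add_le_add h2 h1).trans_eq ?_)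
    simp
    ring
  | succ n ih =>
    have h1 := ih (h.mapsTo hx)
    have h2 := h.abs_pullback_sub_le (n + 1) hx
    have h3 := h.abs_log_ratio_le hx
    have h4 : pullbackDeriv g g' g'' (n + 1) x - invFieldDeriv a g g' g'' x =
        (pullbackDeriv g g' g'' n (g x) - invFieldDeriv a g g' g'' (g x)) -
          (pullback g g' (n + 1) x - invField g g' x) * (g'' x / g' x) := by
      rw [h.invFieldDeriv_eq hx, pullbackDeriv]
      ring
    rw [h4]
    have hn := h.iterate_mem hx (n + 1)
    have h5 : 0 ≤ Real.exp K * (K * Real.exp K) * (x - g x) * (g^[n + 1] x - a) :=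
      mul_nonneg (mul_nonneg (mul_nonneg (Real.exp_pos _).le h.K_mul_exp_nonneg)
        (sub_nonneg.2 (h.le_self hx))) (sub_nonneg.2 hn.1)
    refine (abs_sub _ _).trans ?_
    rw [abs_mul]
    refine (add_le_add h1 (mul_le_mul h2 h3 (abs_nonneg _) h5)).trans_eq ?_
    rw [Function.iterate_succ_apply]
    ring

lemma tendstoUniformlyOn_pullbackDeriv (h : IsContraction a b K L η g g' g'') {d : ℝ}
    (hd : d ∈ Ico a b) :
    TendstoUniformlyOn (pullbackDeriv g g' g'') (invFieldDeriv a g g' g'') atTop (Icc a d) := by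
  -- Bounds the bracket of `abs_pullbackDeriv_sub_le`, because `x - g^[n] x ≤ 1`. Monotonicity of
  -- the iterates then makes `d` the worst point of `[a, d]`.
  set C := K * Real.exp L + K * Real.exp K + Real.exp K * (K * Real.exp K) * K with hC
  have hE : 0 ≤ Real.exp K * (K * Real.exp K) * K :=
    mul_nonneg (mul_nonneg (Real.exp_pos _).le h.K_mul_exp_nonneg) h.K_nonneg
  have hC0 : 0 ≤ C :=
    add_nonneg (add_nonneg (mul_nonneg h.K_nonneg (Real.exp_pos _).le) h.K_mul_exp_nonneg) hE
  have hlim : Tendsto (fun n => C * (g^[n] d - a)) atTop (𝓝 0) := by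
    simpa using ((h.tendsto_iterate hd).sub_const a).const_mul C
  rw [Metric.tendstoUniformlyOn_iff]
  intro ε hε
  filter_upwards [hlim.eventually_lt_const hε] with n hn x hx
  have hxI : x ∈ Ico a b := ⟨hx.1, hx.2.trans_lt hd.2⟩
  have hxn := h.iterate_mem hxI n
  rw [dist_comm, Real.dist_eq]
  refine (h.abs_pullbackDeriv_sub_le n hxI).trans_lt (lt_of_le_of_lt ?_ hn)
  have h1 : x - g^[n] x ≤ 1 := by linarith [h.sub_le, hxI.2, hxn.1]
  have h2 := h.iterate_monotoneOn n hxI hd hx.2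
  exact mul_le_mul (add_le_add_right (mul_le_of_le_one_right hE h1) _)
    (sub_le_sub_right h2 _) (sub_nonneg.2 hxn.1) hC0

lemma continuousOn_invFieldDeriv (h : IsContraction a b K L η g g' g'') :
    ContinuousOn (invFieldDeriv a g g' g'') (Ico a b) := by
  intro x hx
  obtain ⟨d, hd⟩ := exists_between hx.2
  have hdI : d ∈ Ico a b := ⟨hx.1.trans hd.1.le, hd.2⟩
  have h1 := (h.tendstoUniformlyOn_pullbackDeriv hdI).continuousOn
    (Frequently.of_forall fun n => (h.continuousOn_pullbackDeriv n).mono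
      fun z hz => ⟨hz.1, hz.2.trans_lt hd.2⟩)
  refine (h1 x ⟨hx.1, hd.1.le⟩).mono_of_mem_nhdsWithin ?_
  filter_upwards [self_mem_nhdsWithin, nhdsWithin_le_nhds (Iio_mem_nhds hd.1)] with z hz hz'
  exact ⟨hz.1, hz'.le⟩

lemma tendsto_pullback (h : IsContraction a b K L η g g' g'') {x : ℝ} (hx : x ∈ Ico a b) :
    Tendsto (fun n => pullback g g' n x) atTop (𝓝 (invField g g' x)) := by
  rw [tendsto_iff_dist_tendsto_zero]
  refine squeeze_zero (fun _ => dist_nonneg) (fun n => h.abs_pullback_sub_le n hx) ?_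
  simpa using ((h.tendsto_iterate hx).sub_const a).const_mul
    (Real.exp K * (K * Real.exp K) * (x - g x))

lemma hasDerivWithinAt_invField (h : IsContraction a b K L η g g' g'') :
    ∀ x ∈ Ico a b,
      HasDerivWithinAt (invField g g') (invFieldDeriv a g g' g'' x) (Ico a b) x := by
  have hint : ∀ x ∈ Ioo a b, HasDerivAt (invField g g') (invFieldDeriv a g g' g'' x) x := by
    intro x hx
    obtain ⟨d, hd⟩ := exists_between hx.2
    have hdI : d ∈ Ico a b := ⟨hx.1.le.trans hd.1.le, hd.2⟩
    refine hasDerivAt_of_tendstoUniformlyOn isOpen_Ioo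
      ((h.tendstoUniformlyOn_pullbackDeriv hdI).mono Ioo_subset_Icc_self)
      (Eventually.of_forall fun n z hz => ?_)
      (fun z hz => h.tendsto_pullback ⟨hz.1.le, hz.2.trans hd.2⟩) (⟨hx.1, hd.1⟩ : x ∈ Ioo a d)
    have hz' : z ∈ Ioo a b := ⟨hz.1, hz.2.trans hd.2⟩
    exact hasDerivAt_of_mem_Ioo hz'
      (h.hasDerivWithinAt_pullback n z (Ioo_subset_Ico_self hz'))
  intro x hx
  rcases hx.1.eq_or_lt with rfl | hlt
  · refine hasDerivWithinAt_left_endpoint h.lt hint ?_ ?_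
    · rw [ContinuousWithinAt, h.invField_left, tendsto_zero_iff_abs_tendsto_zero]
      have hc : Tendsto (fun x => Real.exp K * (x - g x)) (𝓝[Ico a b] a) (𝓝 0) := by
        have := ((continuousWithinAt_id.sub (h.continuousOn a hx)).tendsto).const_mul (Real.exp K)
        simpa [h.map_left] using this
      refine squeeze_zero' (Eventually.of_forall fun _ => abs_nonneg _) ?_ hc
      filter_upwards [self_mem_nhdsWithin] with z hz using h.abs_invField_le hz
    · have := (h.continuousOn_invFieldDeriv a hx).mono (Ioo_subset_Ico_self)
      rwa [ContinuousWithinAt, nhdsWithin_Ioo_eq_nhdsGT h.lt] at this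
  · exact (hint x ⟨hlt, hx.2⟩).hasDerivWithinAt

end IsContraction

/-! ### Fields with an Abel function -/

/-- `ν` is a `C^1` field on `[a, b)` with derivative `ν'`, vanishing exactly at `a`, and `T` is a
primitive of `1 / ν` on `(a, b)` that conjugates `f` to the unit translation. -/
structure AbelPair (a b : ℝ) (f ν ν' T : ℝ → ℝ) : Prop where
  deriv : ∀ x ∈ Ico a b, HasDerivWithinAt ν (ν' x) (Ico a b) x
  cont : ContinuousOn ν' (Ico a b)
  zero : ν a = 0
  ne_zero : ∀ x ∈ Ioo a b, ν x ≠ 0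
  deriv_abel : ∀ x ∈ Ioo a b, HasDerivAt T (ν x)⁻¹ x
  abel : ∀ x ∈ Ioo a b, T (f x) = T x + 1

/-- Time reversal: the inverse map goes with the opposite field and the opposite Abel function. -/
lemma AbelPair.inverse {a b : ℝ} {f g ν ν' T : ℝ → ℝ} (h : AbelPair a b g ν ν' T)
    (hm : MapsTo f (Ioo a b) (Ioo a b)) (hgf : ∀ x ∈ Ioo a b, g (f x) = x) :
    AbelPair a b f (fun x => -ν x) (fun x => -ν' x) (fun x => -T x) where
  deriv x hx := (h.deriv x hx).neg
  cont := h.cont.neg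
  zero := by simp [h.zero]
  ne_zero x hx := neg_ne_zero.2 (h.ne_zero x hx)
  deriv_abel x hx := (h.deriv_abel x hx).neg.congr_deriv (inv_neg).symm
  abel x hx := by
    have := h.abel (f x) (hm hx)
    rw [hgf x hx] at this
    linarith

/-! ### Existence and uniqueness of the normalized field of a contraction. -/

namespace IsContraction

variable {a b K L η : ℝ} {g g' g'' : ℝ → ℝ}

lemma exp_le_invField_div (h : IsContraction a b K L η g g' g'') {x : ℝ} (hx : x ∈ Ioo a b) :
    Real.exp (-K) ≤ invField g g' x / (g x - x) ∧ invField g g' x / (g x - x) ≤ Real.exp K := by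
  rw [invField, mul_div_cancel_left₀ _ (sub_neg.2 (h.map_lt x hx)).ne, Real.exp_le_exp,
    Real.exp_le_exp, ← abs_le]
  exact h.abs_defectSum_le (Ioo_subset_Ico_self hx)

lemma exists_abelPair (h : IsContraction a b K L η g g' g'') :
    ∃ ν ν' T : ℝ → ℝ, AbelPair a b g ν ν' T ∧
      (∀ x ∈ Ioo a b, Real.exp (-(2 * K + L)) ≤ ν x / (g x - x) ∧
        ν x / (g x - x) ≤ Real.exp (2 * K + L)) ∧
      ∀ x ∈ Ico a b, |ν' x| ≤ Real.exp (K + L) * (η + K * Real.exp K) := by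
  have hcont : ContinuousOn (invField g g') (Ico a b) :=
    fun x hx => (h.hasDerivWithinAt_invField x hx).continuousWithinAt
  obtain ⟨T, hT⟩ := exists_primitive_on_Ioo (h := fun x => (invField g g' x)⁻¹) h.lt
    ((hcont.mono Ioo_subset_Ico_self).inv₀ fun x hx => (h.invField_neg hx).ne)
  obtain ⟨m, hm⟩ := exists_between h.lt
  set τ := T (g m) - T m with hτ
  have hgIoo : ∀ x ∈ Ioo a b, HasDerivAt g (g' x) x := fun x hx =>
    hasDerivAt_of_mem_Ioo hx (h.deriv x (Ioo_subset_Ico_self hx))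
  -- Invariance of the field says precisely that this function has zero derivative.
  have hconst : ∀ x ∈ Ioo a b, T (g x) - T x = τ := by
    have hd : ∀ x ∈ Ioo a b, HasDerivAt (fun x => T (g x) - T x) 0 x := by
      intro x hx
      refine (((hT _ (h.mapsTo_Ioo hx)).comp x (hgIoo x hx)).sub (hT x hx)).congr_deriv ?_
      have h1 := (h.invField_neg hx).ne
      have h2 := (h.deriv_pos (Ioo_subset_Ico_self hx)).ne'
      rw [h.invField_map hx]
      field_simp
      ring
    intro x hx
    refine isOpen_Ioo.is_const_of_deriv_eq_zero isPreconnected_Ioo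
      (fun z hz => (hd z hz).differentiableAt.differentiableWithinAt)
      (fun z hz => (hd z hz).deriv) hx hm
  -- By the mean value theorem `τ` is `m - g m` divided by `-invField g g' c`, with `c` between `g
  -- m` and `m`. Passing from the field to the displacement at `c` costs `exp K`, and from there to
  -- the displacement at `m` costs `exp L`.
  have hbound : Real.exp (-(K + L)) ≤ τ ∧ τ ≤ Real.exp (K + L) := by
    have hlt := h.map_lt m hm
    have hgm := h.mapsTo_Ioo hm
    obtain ⟨c, hc, e⟩ := exists_deriv_mul_eq_sub_of_Ioo hT hgm.1 hlt hm.2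
    have hcI : c ∈ Ioo a b := ⟨hgm.1.trans hc.1, hc.2.trans hm.2⟩
    have hn := h.invField_neg hcI
    have hΔ := sub_pos.2 (h.map_lt c hcI)
    have e' : τ * (-invField g g' c) = m - g m := by
      rw [hτ]
      have : T (g m) - T m = -((invField g g' c)⁻¹ * (m - g m)) := by linarith
      rw [this]
      have := hn.ne
      field_simp
    obtain ⟨h1, h2⟩ := h.exp_le_invField_div hcI
    obtain ⟨h3, h4⟩ := h.displacement_ratio hm ⟨hc.1.le, hc.2.le⟩
    have h5 : invField g g' c / (g c - c) = -invField g g' c / (c - g c) := by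
      rw [← neg_sub c, div_neg, neg_div]
    rw [h5, le_div_iff₀ hΔ] at h1
    rw [h5, div_le_iff₀ hΔ] at h2
    have hpos : 0 < -invField g g' c := neg_pos.2 hn
    constructor
    · refine le_of_mul_le_mul_right ?_ hpos
      rw [e']
      calc Real.exp (-(K + L)) * (-invField g g' c)
          ≤ Real.exp (-(K + L)) * (Real.exp K * (Real.exp L * (m - g m))) := by
            gcongr
            nlinarith [Real.exp_pos K]
        _ = m - g m := by
          rw [← mul_assoc, ← mul_assoc, ← Real.exp_add, ← Real.exp_add]
          simp
    · refine le_of_mul_le_mul_right ?_ hpos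
      rw [e']
      calc m - g m = Real.exp (K + L) * (Real.exp (-K) * (Real.exp (-L) * (m - g m))) := by
            rw [← mul_assoc, ← mul_assoc, ← Real.exp_add, ← Real.exp_add]
            simp
        _ ≤ Real.exp (K + L) * (-invField g g' c) := by
            gcongr
            nlinarith [Real.exp_pos (-K)]
  have hτ0 : 0 < τ := (Real.exp_pos _).trans_le hbound.1
  refine ⟨fun x => τ * invField g g' x, fun x => τ * invFieldDeriv a g g' g'' x,
    fun x => T x / τ, ⟨?_, ?_, ?_, ?_, ?_, ?_⟩, ?_, ?_⟩
  · exact fun x hx => (h.hasDerivWithinAt_invField x hx).const_mul τ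
  · exact h.continuousOn_invFieldDeriv.const_mul τ
  · simp [h.invField_left]
  · exact fun x hx => mul_ne_zero hτ0.ne' (h.invField_neg hx).ne
  · intro x hx
    refine ((hT x hx).div_const τ).congr_deriv ?_
    rw [mul_inv, div_eq_inv_mul]
  · intro x hx
    have := hconst x hx
    field_simp
    linarith
  · intro x hx
    obtain ⟨h1, h2⟩ := h.exp_le_invField_div hx
    have e1 : -(2 * K + L) = -(K + L) + -K := by ring
    have e2 : 2 * K + L = (K + L) + K := by ring
    rw [mul_div_assoc, e1, Real.exp_add, e2, Real.exp_add]
    exact ⟨mul_le_mul hbound.1 h1 (Real.exp_pos _).le hτ0.le,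
      mul_le_mul hbound.2 h2 ((Real.exp_pos _).le.trans h1) (Real.exp_pos _).le⟩
  · intro x hx
    rw [abs_mul, abs_of_pos hτ0]
    exact mul_le_mul hbound.2 (h.abs_invFieldDeriv_le hx) (abs_nonneg _) (Real.exp_pos _).le

/-- Differentiate Abel's equation. -/
lemma abelPair_map (h : IsContraction a b K L η g g' g'') {ν ν' T : ℝ → ℝ}
    (hA : AbelPair a b g ν ν' T) {x : ℝ} (hx : x ∈ Ioo a b) : ν (g x) = g' x * ν x := by
  have hg := hasDerivAt_of_mem_Ioo hx (h.deriv x (Ioo_subset_Ico_self hx))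
  have h1 := (hA.deriv_abel _ (h.mapsTo_Ioo hx)).comp x hg
  have h2 : HasDerivAt (T ∘ g) (ν x)⁻¹ x :=
    ((hA.deriv_abel x hx).add_const 1).congr_of_eventuallyEq
      (by filter_upwards [Ioo_mem_nhds hx.1 hx.2] with z hz using hA.abel z hz)
  have h3 := h1.unique h2
  have h4 := hA.ne_zero x hx
  have h5 := hA.ne_zero _ (h.mapsTo_Ioo hx)
  field_simp at h3
  linarith

/-- Kopell-type argument. The zero at `x` propagates along its orbit, which forces `μ' a = 0`. Hence
`μ` at the `n`-th iterate of `y` is negligible against the length of the `n`-th fundamental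
interval, while `ν` there is at least a fixed multiple of that length. But `μ / ν` is constant along
the orbit of `y`, so it is zero. -/
lemma eq_zero_of_invariant (h : IsContraction a b K L η g g' g'') {ν μ μ' : ℝ → ℝ} {c : ℝ}
    (hc : 0 < c) (hν : ∀ x ∈ Ioo a b, c * (x - g x) ≤ |ν x|)
    (hνmap : ∀ x ∈ Ioo a b, ν (g x) = g' x * ν x)
    (hμ : ∀ x ∈ Ico a b, HasDerivWithinAt μ (μ' x) (Ico a b) x) (hμ' : ContinuousOn μ' (Ico a b))
    (hμ0 : μ a = 0) (hμmap : ∀ x ∈ Ioo a b, μ (g x) = g' x * μ x)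
    {x y : ℝ} (hx : x ∈ Ioo a b) (hy : y ∈ Icc (g x) x) (hμx : μ x = 0) : μ y = 0 := by
  have hxI := Ioo_subset_Ico_self hx
  have hyo : y ∈ Ioo a b := ⟨(h.mapsTo_Ioo hx).1.trans_le hy.1, hy.2.trans_lt hx.2⟩
  have hyI := Ioo_subset_Ico_self hyo
  have hνy : ν y ≠ 0 := by
    have := hν y hyo
    have h1 := mul_pos hc (sub_pos.2 (h.map_lt y hyo))
    exact abs_pos.1 (h1.trans_le this)
  have hzero : ∀ n, μ (g^[n] x) = 0 := by
    intro n
    induction n with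
    | zero => exact hμx
    | succ n ih => rw [Function.iterate_succ_apply', hμmap _ (h.iterate_mem_Ioo hx n), ih, mul_zero]
  have hratio : ∀ n, μ (g^[n] y) * ν y = ν (g^[n] y) * μ y := by
    intro n
    induction n with
    | zero => simp [mul_comm]
    | succ n ih =>
      rw [Function.iterate_succ_apply', hμmap _ (h.iterate_mem_Ioo hyo n),
        hνmap _ (h.iterate_mem_Ioo hyo n), mul_assoc, ih, mul_assoc]
  have hlim := h.tendsto_iterate hxI
  have hlimI : Tendsto (fun n => g^[n] x) atTop (𝓝[Ico a b] a) :=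
    tendsto_nhdsWithin_iff.2 ⟨hlim, Eventually.of_forall fun n => h.iterate_mem hxI n⟩
  have hμ'a : μ' a = 0 := by
    have h1 := (hasDerivWithinAt_iff_tendsto_slope.1 (hμ a h.left_mem))
    have h2 : Tendsto (fun n => g^[n] x) atTop (𝓝[Ico a b \ {a}] a) :=
      tendsto_nhdsWithin_iff.2 ⟨hlim, Eventually.of_forall fun n =>
        ⟨h.iterate_mem hxI n, (h.iterate_mem_Ioo hx n).1.ne'⟩⟩
    have h3 := h1.comp h2
    refine tendsto_nhds_unique h3 (tendsto_const_nhds.congr fun n => ?_)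
    simp [slope, hzero n, hμ0]
  by_contra hne
  -- Half of the factor by which `|μ|` at the iterates of `y` would dominate the lengths of the
  -- fundamental intervals.
  set ε := c * Real.exp (-L) * |μ y / ν y| / 2 with hε
  have hεpos : 0 < ε := by
    have : 0 < |μ y / ν y| := abs_pos.2 (div_ne_zero hne hνy)
    positivity
  have hsmall : ∀ᶠ z in 𝓝[Ico a b] a, |μ' z| < ε := by
    have := (hμ' a h.left_mem).abs
    rw [ContinuousWithinAt, hμ'a, abs_zero] at this
    exact this.eventually_lt_const hεpos
  obtain ⟨d, hd, hdε⟩ : ∃ d > a, ∀ z ∈ Ico a b, z < d → |μ' z| < ε := by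
    rw [eventually_nhdsWithin_iff] at hsmall
    obtain ⟨l, u, hlu, hsub⟩ := mem_nhds_iff_exists_Ioo_subset.1 hsmall
    exact ⟨u, hlu.2, fun z hz hzu => hsub ⟨hlu.1.trans_le hz.1, hzu⟩ hz⟩
  obtain ⟨n, hn⟩ := (hlim.eventually_lt_const hd).exists
  have hxn := h.iterate_mem_Ioo hx n
  have hyn := h.iterate_mem_Ioo hyo n
  have hle : g^[n] y ≤ g^[n] x := h.iterate_monotoneOn n hyI hxI hy.2
  have hge : g (g^[n] x) ≤ g^[n] y := by
    rw [← Function.iterate_succ_apply' g, Function.iterate_succ_apply]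
    exact h.iterate_monotoneOn n (h.mapsTo hxI) hyI hy.1
  have h1 : |μ (g^[n] x) - μ (g^[n] y)| ≤ ε * (g^[n] x - g^[n] y) :=
    abs_sub_le_of_abs_deriv_le hμ hyn.1.le hle hxn.2 fun z hz =>
      (hdε z ⟨hyn.1.le.trans hz.1.le, hz.2.trans hxn.2⟩ (hz.2.trans hn)).le
  rw [hzero, zero_sub, abs_neg] at h1
  have h2 := (h.displacement_ratio hxn ⟨hge, hle⟩).1
  have h3 := hν _ hyn
  have hΔ := sub_pos.2 (h.map_lt _ hxn)
  have h4 : μ (g^[n] y) = ν (g^[n] y) * (μ y / ν y) := by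
    rw [← mul_div_assoc, eq_div_iff hνy, hratio n]
  rw [h4, abs_mul] at h1
  have h5 : c * (Real.exp (-L) * (g^[n] x - g (g^[n] x))) * |μ y / ν y| ≤
      |ν (g^[n] y)| * |μ y / ν y| :=
    mul_le_mul_of_nonneg_right ((mul_le_mul_of_nonneg_left h2 hc.le).trans h3) (abs_nonneg _)
  have h6 : ε * (g^[n] x - g^[n] y) ≤ ε * (g^[n] x - g (g^[n] x)) :=
    mul_le_mul_of_nonneg_left (sub_le_sub_left hge _) hεpos.le
  have h7 : c * (Real.exp (-L) * (g^[n] x - g (g^[n] x))) * |μ y / ν y| =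
      2 * (ε * (g^[n] x - g (g^[n] x))) := by rw [hε]; ring
  have h8 := mul_pos hεpos hΔ
  linarith

/-- Uniqueness of the field with an Abel function. -/
lemma abelPair_unique (h : IsContraction a b K L η g g' g'') {ν ν' T μ μ' M : ℝ → ℝ} {c : ℝ}
    (hc : 0 < c) (hν : ∀ x ∈ Ioo a b, c * (x - g x) ≤ |ν x|)
    (hA : AbelPair a b g ν ν' T) (hB : AbelPair a b g μ μ' M) : EqOn μ ν (Ico a b) := by
  intro x hx
  rcases hx.1.eq_or_lt with rfl | hlt
  · rw [hA.zero, hB.zero]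
  have hxo : x ∈ Ioo a b := ⟨hlt, hx.2⟩
  have hgx := h.mapsTo_Ioo hxo
  set Q := μ x / ν x with hQ
  -- The combination `μ - Q ν` is invariant and vanishes at `x`, hence on the whole fundamental
  -- interval.
  have key : ∀ y ∈ Icc (g x) x, μ y - Q * ν y = 0 := fun y hy =>
    h.eq_zero_of_invariant (μ := fun y => μ y - Q * ν y) (μ' := fun y => μ' y - Q * ν' y) hc hν
      (fun _ => h.abelPair_map hA) (fun z hz => (hB.deriv z hz).sub ((hA.deriv z hz).const_mul Q))
      (hB.cont.sub (hA.cont.const_mul Q)) (by simp [hA.zero, hB.zero])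
      (fun z hz => by rw [h.abelPair_map hA hz, h.abelPair_map hB hz]; ring)
      hxo hy (by simp [hQ, div_mul_cancel₀ _ (hA.ne_zero x hxo)])
  -- Both Abel functions change by `1` between `x` and `g x`; Rolle for their difference gives a
  -- point where the fields agree, so `Q = 1`.
  obtain ⟨y, hy, e⟩ := exists_deriv_mul_eq_sub_of_Ioo (F := fun x => M x - T x)
    (fun z hz => (hB.deriv_abel z hz).sub (hA.deriv_abel z hz)) hgx.1 (h.map_lt x hxo) hx.2
  have hyo : y ∈ Ioo a b := ⟨hgx.1.trans hy.1, hy.2.trans hx.2⟩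
  have h0 : (μ y)⁻¹ - (ν y)⁻¹ = 0 := by
    have : M x - T x - (M (g x) - T (g x)) = 0 := by rw [hA.abel x hxo, hB.abel x hxo]; ring
    rw [this] at e
    exact (mul_eq_zero.1 e.symm).resolve_right (sub_pos.2 (h.map_lt x hxo)).ne'
  have h1 : μ y = ν y := inv_injective (sub_eq_zero.1 h0)
  have h2 := key y ⟨hy.1.le, hy.2.le⟩
  have h3 : Q = 1 := by
    rw [h1] at h2
    have : (1 - Q) * ν y = 0 := by linarith
    linarith [(mul_eq_zero.1 this).resolve_right (hA.ne_zero y hyo)]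
  rwa [hQ, div_eq_one_iff_eq (hA.ne_zero x hxo)] at h3

end IsContraction

/-! ### The flow of a field with an Abel function -/

lemma pos_or_neg_of_ne_zero {a b : ℝ} {h : ℝ → ℝ} (hc : ContinuousOn h (Ioo a b))
    (h0 : ∀ x ∈ Ioo a b, h x ≠ 0) : (∀ x ∈ Ioo a b, 0 < h x) ∨ ∀ x ∈ Ioo a b, h x < 0 := by
  by_contra! hcon
  obtain ⟨⟨x, hx, hx0⟩, y, hy, hy0⟩ := hcon
  obtain ⟨z, hz, e⟩ := isPreconnected_Ioo.intermediate_value hx hy hc ⟨hx0, hy0⟩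
  exact h0 z hz e

lemma exists_inverse_of_deriv_pos {a b : ℝ} {ν T : ℝ → ℝ}
    (hT : ∀ x ∈ Ioo a b, HasDerivAt T (ν x)⁻¹ x) (hpos : ∀ x ∈ Ioo a b, 0 < ν x)
    (hsurj : ∀ t, ∃ x ∈ Ioo a b, T x = t) :
    ∃ S : ℝ → ℝ, (∀ t, S t ∈ Ioo a b ∧ T (S t) = t ∧ HasDerivAt S (ν (S t)) t) ∧
      ∀ x ∈ Ioo a b, S (T x) = x := by
  have hmono : StrictMonoOn T (Ioo a b) := by
    refine strictMonoOn_of_deriv_pos (convex_Ioo a b)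
      (fun x hx => (hT x hx).continuousAt.continuousWithinAt) fun x hx => ?_
    rw [interior_Ioo] at hx
    rw [(hT x hx).deriv]
    exact inv_pos.2 (hpos x hx)
  choose S hS hTS using hsurj
  have hST : ∀ x ∈ Ioo a b, S (T x) = x := fun x hx => hmono.injOn (hS _) hx (hTS _)
  have hSmono : Monotone S := fun s t hst => by
    rw [← hmono.le_iff_le (hS s) (hS t), hTS, hTS]
    exact hst
  have himg : Ioo a b ⊆ S '' univ := fun x hx => ⟨T x, trivial, hST x hx⟩
  refine ⟨S, fun t => ⟨hS t, hTS t, ?_⟩, hST⟩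
  -- A monotone function whose image fills a neighbourhood of a value is continuous there.
  have hcont : ContinuousAt S t :=
    continuousAt_of_monotoneOn_of_image_mem_nhds (hSmono.monotoneOn univ) univ_mem
      (mem_of_superset (Ioo_mem_nhds (hS t).1 (hS t).2) himg)
  have := HasDerivAt.of_local_left_inverse hcont (hT _ (hS t)) (inv_ne_zero (hpos _ (hS t)).ne')
    (Eventually.of_forall hTS)
  rwa [inv_inv] at this

namespace AbelPair

variable {a b : ℝ} {f ν ν' T : ℝ → ℝ}

lemma continuousOn_field (h : AbelPair a b f ν ν' T) : ContinuousOn ν (Ico a b) :=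
  fun x hx => (h.deriv x hx).continuousWithinAt

lemma pos_or_neg (h : AbelPair a b f ν ν' T) :
    (∀ x ∈ Ioo a b, 0 < ν x) ∨ ∀ x ∈ Ioo a b, ν x < 0 :=
  pos_or_neg_of_ne_zero (h.continuousOn_field.mono Ioo_subset_Ico_self) h.ne_zero

/-- By Abel's equation, orbits of `f` and of its inverse reach the values `T m ± n`; the
intermediate value theorem fills the gaps. -/
lemma surjective (h : AbelPair a b f ν ν' T) (hab : a < b) (hf : BijOn f (Ioo a b) (Ioo a b))
    (t : ℝ) : ∃ x ∈ Ioo a b, T x = t := by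
  obtain ⟨m, hm⟩ := exists_between hab
  have hup : ∀ n : ℕ, ∃ x ∈ Ioo a b, T x = T m + n := by
    intro n
    induction n with
    | zero => exact ⟨m, hm, by simp⟩
    | succ n ih =>
      obtain ⟨x, hx, e⟩ := ih
      exact ⟨f x, hf.mapsTo hx, by rw [h.abel x hx, e]; push_cast; ring⟩
  have hdown : ∀ n : ℕ, ∃ x ∈ Ioo a b, T x = T m - n := by
    intro n
    induction n with
    | zero => exact ⟨m, hm, by simp⟩
    | succ n ih =>
      obtain ⟨x, hx, e⟩ := ih
      obtain ⟨y, hy, rfl⟩ := hf.surjOn hx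
      refine ⟨y, hy, ?_⟩
      rw [h.abel y hy] at e
      push_cast
      linarith
  obtain ⟨n, hn⟩ := exists_nat_ge |t - T m|
  obtain ⟨x, hx, ex⟩ := hdown n
  obtain ⟨y, hy, ey⟩ := hup n
  have := abs_le.1 hn
  obtain ⟨z, hz, e⟩ := isPreconnected_Ioo.intermediate_value hx hy
    (fun z hz => (h.deriv_abel z hz).continuousAt.continuousWithinAt)
    (show t ∈ Icc (T x) (T y) from ⟨by rw [ex]; linarith, by rw [ey]; linarith⟩)
  exact ⟨z, hz, e⟩

lemma exists_inverse (h : AbelPair a b f ν ν' T) (hab : a < b)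
    (hf : BijOn f (Ioo a b) (Ioo a b)) :
    ∃ S : ℝ → ℝ, (∀ t, S t ∈ Ioo a b ∧ T (S t) = t ∧ HasDerivAt S (ν (S t)) t) ∧
      ∀ x ∈ Ioo a b, S (T x) = x := by
  rcases h.pos_or_neg with hs | hs
  · exact exists_inverse_of_deriv_pos h.deriv_abel hs (h.surjective hab hf)
  · obtain ⟨S, hS, hST⟩ := exists_inverse_of_deriv_pos (ν := fun x => -ν x) (T := fun x => -T x)
      (fun x hx => (h.deriv_abel x hx).neg.congr_deriv (inv_neg).symm)
      (fun x hx => neg_pos.2 (hs x hx))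
      (fun t => (h.surjective hab hf (-t)).imp fun x hx => ⟨hx.1, by rw [hx.2, neg_neg]⟩)
    refine ⟨fun t => S (-t), fun t => ⟨(hS (-t)).1, ?_, ?_⟩, fun x hx => hST x hx⟩
    · have := (hS (-t)).2.1
      linarith
    · exact ((hS (-t)).2.2.comp t (hasDerivAt_neg t)).congr_deriv (by ring)

/-- The flow of a field with an Abel function, with its derivative in space. -/
lemma exists_flow (h : AbelPair a b f ν ν' T) (hab : a < b) (hf : BijOn f (Ioo a b) (Ioo a b))
    (hfa : f a = a) :
    ∃ φ : ℝ → ℝ → ℝ, IsFlowOn (Ico a b) ν φ ∧ EqOn (φ 1) f (Ico a b) ∧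
      ∀ x ∈ Ioo a b, ∀ t, φ t x ∈ Ioo a b ∧ HasDerivAt (φ t) (ν (φ t x) / ν x) x := by
  obtain ⟨S, hS, hST⟩ := h.exists_inverse hab hf
  -- In the coordinate `T` the flow is translation; `a`, where `T` carries no information, is put in
  -- by hand as a rest point.
  refine ⟨fun t x => if x = a then a else S (T x + t), ?_, ?_, ?_⟩
  · intro x hx
    rcases hx.1.eq_or_lt with rfl | hlt
    · refine ⟨by simp, fun t => by simpa using hab, fun t => ?_⟩
      simpa [h.zero] using hasDerivAt_const t a
    · simp only [hlt.ne', if_false]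
      refine ⟨by rw [add_zero, hST x ⟨hlt, hx.2⟩],
        fun t => Ioo_subset_Ico_self (hS _).1, fun t => ?_⟩
      exact ((hS (T x + t)).2.2.comp_const_add (T x) t)
  · intro x hx
    rcases hx.1.eq_or_lt with rfl | hlt
    · simp [hfa]
    · have hxo : x ∈ Ioo a b := ⟨hlt, hx.2⟩
      simp only [hlt.ne', if_false]
      rw [← h.abel x hxo, hST _ (hf.mapsTo hxo)]
  · intro x hx t
    simp only [hx.1.ne', if_false]
    refine ⟨(hS _).1, ?_⟩
    have h1 : HasDerivAt (fun x => S (T x + t)) (ν (S (T x + t)) / ν x) x :=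
      ((hS (T x + t)).2.2.comp x ((h.deriv_abel x hx).add_const t)).congr_deriv
        (div_eq_mul_inv _ _).symm
    refine h1.congr_of_eventuallyEq ?_
    filter_upwards [Ioi_mem_nhds hx.1] with z hz
    simp [(mem_Ioi.1 hz).ne']

end AbelPair

/-! ### Uniqueness and regularity of the flow. -/

lemma lipschitzOnWith_of_abs_deriv_le {s : Set ℝ} (hs : Convex ℝ s) {ν ν' : ℝ → ℝ} {B : ℝ}
    (h : ∀ x ∈ s, HasDerivWithinAt ν (ν' x) s x) (hB : ∀ x ∈ s, |ν' x| ≤ B) :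
    LipschitzOnWith B.toNNReal ν s := by
  refine hs.lipschitzOnWith_of_nnnorm_hasDerivWithin_le h fun x hx => ?_
  rw [← NNReal.coe_le_coe, coe_nnnorm, Real.norm_eq_abs]
  exact (hB x hx).trans (Real.le_coe_toNNReal B)

lemma IsFlowOn.unique {s : Set ℝ} {ν : ℝ → ℝ} {C : NNReal} (hν : LipschitzOnWith C ν s)
    {φ ψ : ℝ → ℝ → ℝ} (hφ : IsFlowOn s ν φ) (hψ : IsFlowOn s ν ψ) (t : ℝ) : EqOn (φ t) (ψ t) s := by
  intro x hx
  have := ODE_solution_unique_univ (v := fun _ => ν) (s := fun _ => s) (t₀ := 0) (fun _ => hν)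
    (fun t => ⟨(hφ x hx).2.2 t, (hφ x hx).2.1 t⟩) (fun t => ⟨(hψ x hx).2.2 t, (hψ x hx).2.1 t⟩)
    ((hφ x hx).1.trans (hψ x hx).1.symm)
  exact congrFun this t

lemma IsFlowOn.abs_sub_le {s : Set ℝ} {ν : ℝ → ℝ} {A : ℝ} {φ : ℝ → ℝ → ℝ} (hφ : IsFlowOn s ν φ)
    (hA : ∀ x ∈ s, |ν x| ≤ A) {t x : ℝ} (ht : 0 ≤ t) (hx : x ∈ s) : |φ t x - x| ≤ t * A := by
  have := abs_sub_le_of_abs_deriv_le (a := 0) (b := t + 1) (F := fun t => φ t x)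
    (fun z _ => ((hφ x hx).2.2 z).hasDerivWithinAt) le_rfl ht (by linarith)
    (fun z _ => hA _ ((hφ x hx).2.1 z))
  simpa [(hφ x hx).1, mul_comm] using this

/-- Regularity and displacement bound for the time-`t` map of a field with an Abel function. -/
lemma AbelPair.flow_hasDerivWithinAt {a b B : ℝ} {f ν ν' T : ℝ → ℝ} {φ : ℝ → ℝ → ℝ}
    (h : AbelPair a b f ν ν' T) (hab : a < b) (hB : ∀ x ∈ Ico a b, |ν' x| ≤ B)
    (hφ : IsFlowOn (Ico a b) ν φ)
    (hφ' : ∀ x ∈ Ioo a b, ∀ t, φ t x ∈ Ioo a b ∧ HasDerivAt (φ t) (ν (φ t x) / ν x) x)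
    {t : ℝ} (ht : t ∈ Icc (0 : ℝ) 1) :
    ∃ D : ℝ → ℝ, ContinuousOn D (Ico a b) ∧
      ∀ x ∈ Ico a b, HasDerivWithinAt (φ t) (D x) (Ico a b) x ∧
        |D x - 1| ≤ t * (B * Real.exp B) := by
  have haI : a ∈ Ico a b := ⟨le_rfl, hab⟩
  have hB0 : 0 ≤ B := (abs_nonneg _).trans (hB a haI)
  have hLip := lipschitzOnWith_of_abs_deriv_le (convex_Ico a b) h.deriv hB
  have hφa : ∀ s, φ s a = a := fun s => by
    have := ODE_solution_unique_univ (v := fun _ => ν) (s := fun _ => Ico a b) (t₀ := 0)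
      (g := fun _ => a) (fun _ => hLip) (fun t => ⟨(hφ a haI).2.2 t, (hφ a haI).2.1 t⟩)
      (fun t => ⟨by simpa [h.zero] using hasDerivAt_const t a, haI⟩) (hφ a haI).1
    exact congrFun this s
  -- Grönwall against the rest point `a`: convergence to `a` is uniform in the time, so the time may
  -- be allowed to depend on `x` below.
  have hgron : ∀ x ∈ Ico a b, ∀ s ∈ Icc (0 : ℝ) 1, |φ s x - a| ≤ (x - a) * Real.exp B := by
    intro x hx s hs
    have h1 := dist_le_of_trajectories_ODE_of_mem (v := fun _ => ν) (s := fun _ => Ico a b)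
      (a := 0) (b := 1) (f := fun s => φ s x) (g := fun s => φ s a) (δ := x - a)
      (fun _ _ => hLip)
      (fun z _ => ((hφ x hx).2.2 z).continuousAt.continuousWithinAt)
      (fun z _ => ((hφ x hx).2.2 z).hasDerivWithinAt) (fun z _ => (hφ x hx).2.1 z)
      (fun z _ => ((hφ a haI).2.2 z).continuousAt.continuousWithinAt)
      (fun z _ => ((hφ a haI).2.2 z).hasDerivWithinAt) (fun z _ => (hφ a haI).2.1 z)
      (by simp only [(hφ x hx).1, (hφ a haI).1, Real.dist_eq]
          exact (abs_of_nonneg (sub_nonneg.2 hx.1)).le) s hs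
    simp only [hφa, Real.dist_eq, sub_zero, Real.coe_toNNReal B hB0] at h1
    refine h1.trans (mul_le_mul_of_nonneg_left (Real.exp_le_exp.2 ?_) (sub_nonneg.2 hx.1))
    exact mul_le_of_le_one_right hB0 hs.2
  -- Mean value theorem in time for `log |ν (φ s x)|`, whose derivative is `ν' (φ s x)`. The
  -- membership is placed inside the existential so that `choose` returns a function of `x` alone.
  have hratio : ∀ x, ∃ s, x ∈ Ioo a b → s ∈ Icc (0 : ℝ) 1 ∧
      ν (φ t x) / ν x = Real.exp (t * ν' (φ s x)) := by
    intro x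
    by_cases hx : x ∈ Ioo a b
    swap
    · exact ⟨0, fun hx' => absurd hx' hx⟩
    have hxI := Ioo_subset_Ico_self hx
    have hpos : 0 < ν (φ t x) / ν x := by
      rcases h.pos_or_neg with hs | hs
      · exact div_pos (hs _ (hφ' x hx t).1) (hs x hx)
      · exact div_pos_of_neg_of_neg (hs _ (hφ' x hx t).1) (hs x hx)
    have hlog : Real.log (ν (φ t x) / ν x) = Real.log (ν (φ t x)) - Real.log (ν x) :=
      Real.log_div (h.ne_zero _ (hφ' x hx t).1) (h.ne_zero x hx)
    have hd : ∀ s, HasDerivAt (fun s => Real.log (ν (φ s x))) (ν' (φ s x)) s := by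
      intro s
      have h0 := h.ne_zero _ (hφ' x hx s).1
      have h1 := hasDerivAt_of_mem_Ioo (hφ' x hx s).1
        (h.deriv _ (Ioo_subset_Ico_self (hφ' x hx s).1))
      refine ((h1.comp s ((hφ x hxI).2.2 s)).log h0).congr_deriv ?_
      simp only [Function.comp]
      field_simp
    rcases ht.1.eq_or_lt with rfl | htpos
    · refine ⟨0, fun _ => ⟨⟨le_rfl, zero_le_one⟩, ?_⟩⟩
      rw [(hφ x hxI).1, div_self (h.ne_zero x hx)]
      simp
    · obtain ⟨s, hs, e⟩ := exists_deriv_mul_eq_sub (a := 0) (b := t + 1)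
        (fun z _ => (hd z).hasDerivWithinAt) le_rfl htpos (by linarith)
      refine ⟨s, fun _ => ⟨⟨hs.1.le, hs.2.le.trans ht.2⟩, ?_⟩⟩
      rw [← Real.exp_log hpos, hlog]
      rw [(hφ x hxI).1, sub_zero] at e
      rw [e, mul_comm]
  choose s hs using hratio
  -- The value at `a` is the limit of `exp (t * ν' (φ (s x) x))` as `x` tends to `a`.
  set D : ℝ → ℝ := fun x => if x = a then Real.exp (t * ν' a) else ν (φ t x) / ν x with hD
  have hDa : D a = Real.exp (t * ν' a) := by simp [hD]
  have hDx : ∀ x ∈ Ioo a b, D x = ν (φ t x) / ν x := fun x hx => by simp [hD, hx.1.ne']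
  have hbd : ∀ y ∈ Ico a b, |Real.exp (t * ν' y) - 1| ≤ t * (B * Real.exp B) := by
    intro y hy
    have h1 : |t * ν' y| ≤ t * B := by
      rw [abs_mul, abs_of_nonneg ht.1]
      exact mul_le_mul_of_nonneg_left (hB y hy) ht.1
    have h2 : t * B ≤ B := mul_le_of_le_one_left hB0 ht.2
    refine (abs_exp_sub_one_le_abs_mul_exp _).trans ?_
    rw [← mul_assoc]
    exact mul_le_mul h1 (Real.exp_le_exp.2 (h1.trans h2)) (Real.exp_pos _).le
      (mul_nonneg ht.1 hB0)
  have hsq : Tendsto (fun x => a + (x - a) * Real.exp B) (𝓝[>] a) (𝓝 a) := by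
    have : Continuous fun x => a + (x - a) * Real.exp B := by fun_prop
    simpa using (this.tendsto a).mono_left nhdsWithin_le_nhds
  have hnhds : Ioo a b ∈ 𝓝[>] a := Ioo_mem_nhdsGT hab
  have hlimφ : ∀ r : ℝ → ℝ, (∀ x ∈ Ioo a b, r x ∈ Icc (0 : ℝ) 1) →
      Tendsto (fun x => φ (r x) x) (𝓝[>] a) (𝓝 a) := by
    intro r hr
    refine tendsto_of_tendsto_of_tendsto_of_le_of_le' tendsto_const_nhds hsq ?_ ?_
    · filter_upwards [hnhds] with x hx using (hφ' x hx _).1.1.le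
    · filter_upwards [hnhds] with x hx
      have := (abs_le.1 (hgron x (Ioo_subset_Ico_self hx) _ (hr x hx))).2
      linarith
  have hDlim : Tendsto D (𝓝[>] a) (𝓝 (D a)) := by
    have h1 : Tendsto (fun x => φ (s x) x) (𝓝[>] a) (𝓝[Ico a b] a) := by
      refine tendsto_nhdsWithin_iff.2 ⟨hlimφ s fun x hx => (hs x hx).1, ?_⟩
      filter_upwards [hnhds] with x hx using Ioo_subset_Ico_self (hφ' x hx _).1
    have h2 := (Real.continuous_exp.tendsto _).comp
      (((h.cont a haI).tendsto.comp h1).const_mul t)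
    rw [hDa]
    refine h2.congr' ?_
    filter_upwards [hnhds] with x hx
    rw [hDx x hx, (hs x hx).2]
    rfl
  have hDder : ∀ x ∈ Ioo a b, HasDerivAt (φ t) (D x) x := fun x hx => by
    rw [hDx x hx]
    exact (hφ' x hx t).2
  refine ⟨D, fun x hx => ?_, fun x hx => ?_⟩
  · rcases hx.1.eq_or_lt with rfl | hlt
    · exact (continuousWithinAt_Ioi_iff_Ici.1 hDlim).mono Ico_subset_Ici_self
    · have hxo : x ∈ Ioo a b := ⟨hlt, hx.2⟩
      have hν : ∀ y ∈ Ioo a b, ContinuousAt ν y := fun y hy =>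
        (hasDerivAt_of_mem_Ioo hy (h.deriv y (Ioo_subset_Ico_self hy))).continuousAt
      have h1 : ContinuousAt (fun x => ν (φ t x) / ν x) x :=
        (ContinuousAt.comp (hν _ (hφ' x hxo t).1) (hφ' x hxo t).2.continuousAt).div
          (hν x hxo) (h.ne_zero x hxo)
      refine (h1.congr ?_).continuousWithinAt
      filter_upwards [Ioo_mem_nhds hlt hx.2] with z hz using (hDx z hz).symm
  · rcases hx.1.eq_or_lt with rfl | hlt
    · refine ⟨hasDerivWithinAt_left_endpoint hab hDder ?_ hDlim, ?_⟩
      · have : ContinuousWithinAt (φ t) (Ioi a) a := by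
          rw [ContinuousWithinAt, hφa]
          exact hlimφ (fun _ => t) fun _ _ => ht
        exact (continuousWithinAt_Ioi_iff_Ici.1 this).mono Ico_subset_Ici_self
      · rw [hDa]
        exact hbd a haI
    · have hxo : x ∈ Ioo a b := ⟨hlt, hx.2⟩
      refine ⟨(hDder x hxo).hasDerivWithinAt, ?_⟩
      rw [hDx x hxo, (hs x hxo).2]
      exact hbd _ (Ioo_subset_Ico_self (hφ' x hxo _).1)

/-! ### Szekeres fields have an Abel function -/

/-- An integral curve that meets a zero of a `C^1` field is constant. -/
lemma integralCurve_const {a b : ℝ} {μ μ' γ : ℝ → ℝ}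
    (hμ : ∀ x ∈ Ico a b, HasDerivWithinAt μ (μ' x) (Ico a b) x) (hμ' : ContinuousOn μ' (Ico a b))
    (hγ : MapsTo γ (Icc 0 1) (Ico a b)) (hγ' : IsIntegralCurveOn γ (fun _ => μ) (Icc 0 1))
    {s : ℝ} (hs : s ∈ Icc (0 : ℝ) 1) (h0 : μ (γ s) = 0) : ∀ t ∈ Icc (0 : ℝ) 1, γ t = γ s := by
  have hcont : ContinuousOn γ (Icc 0 1) := fun t ht => (hγ' t ht).continuousWithinAt
  -- A `C^1` field need not be Lipschitz on all of `[a, b)`, but the curve stays in the compact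
  -- interval `[a, γ m]`, where it is.
  obtain ⟨m, hm, hmax⟩ := isCompact_Icc.exists_isMaxOn ⟨s, hs⟩ hcont
  have hsub : Icc a (γ m) ⊆ Ico a b := fun z hz => ⟨hz.1, hz.2.trans_lt (hγ hm).2⟩
  have hmem : ∀ t ∈ Icc (0 : ℝ) 1, γ t ∈ Icc a (γ m) := fun t ht => ⟨(hγ ht).1, hmax ht⟩
  obtain ⟨C, hC⟩ := isCompact_Icc.exists_bound_of_continuousOn (hμ'.mono hsub)
  have hLip := lipschitzOnWith_of_abs_deriv_le (convex_Icc a (γ m))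
    (fun x hx => (hμ x (hsub hx)).mono hsub) hC
  intro t ht
  rcases le_total s t with hst | hst
  · have := ODE_solution_unique_of_mem_Icc_right (v := fun _ => μ) (s := fun _ => Icc a (γ m))
      (a := s) (b := 1) (f := γ) (g := fun _ => γ s) (fun _ _ => hLip)
      (hcont.mono (Icc_subset_Icc_left hs.1))
      (fun z hz => (hγ' z ⟨hs.1.trans hz.1, hz.2.le⟩).mono_of_mem_nhdsWithin
        (Icc_mem_nhdsGE_of_mem ⟨hs.1.trans hz.1, hz.2⟩))
      (fun z hz => hmem z ⟨hs.1.trans hz.1, hz.2.le⟩) continuousOn_const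
      (fun z _ => by rw [h0]; exact hasDerivWithinAt_const _ _ _) (fun _ _ => hmem s hs) rfl
    exact this ⟨hst, ht.2⟩
  · have := ODE_solution_unique_of_mem_Icc_left (v := fun _ => μ) (s := fun _ => Icc a (γ m))
      (a := 0) (b := s) (f := γ) (g := fun _ => γ s) (fun _ _ => hLip)
      (hcont.mono (Icc_subset_Icc_right hs.2))
      (fun z hz => (hγ' z ⟨hz.1.le, hz.2.trans hs.2⟩).mono_of_mem_nhdsWithin
        (Icc_mem_nhdsLE_of_mem ⟨hz.1, hz.2.trans hs.2⟩))
      (fun z hz => hmem z ⟨hz.1.le, hz.2.trans hs.2⟩) continuousOn_const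
      (fun z _ => by rw [h0]; exact hasDerivWithinAt_const _ _ _) (fun _ _ => hmem s hs) rfl
    exact this ⟨ht.1, hst⟩

/-- A zero of the field on the curve joining `x` to `f x` would make `x` a fixed point, so away from
`a` a primitive of `1 / μ` exists; along the curve it grows at unit speed. -/
lemma IsSzekeresField.exists_abelPair {a b : ℝ} {f μ : ℝ → ℝ} (hab : a < b)
    (hfix : ∀ x ∈ Ico a b, f x = x ↔ x = a) (h : IsSzekeresField a b f μ) :
    ∃ T, AbelPair a b f μ (derivWithin μ (Ico a b)) T := by
  obtain ⟨hC1, hflow⟩ := h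
  obtain ⟨hdiff, hcont⟩ := (contDiffOn_one_iff_derivWithin (uniqueDiffOn_Ico a b)).1 hC1
  have hd : ∀ x ∈ Ico a b, HasDerivWithinAt μ (derivWithin μ (Ico a b) x) (Ico a b) x :=
    fun x hx => (hdiff x hx).hasDerivWithinAt
  have haI : a ∈ Ico a b := ⟨le_rfl, hab⟩
  have h01 : (0 : ℝ) ∈ Icc (0 : ℝ) 1 := ⟨le_rfl, zero_le_one⟩
  have h11 : (1 : ℝ) ∈ Icc (0 : ℝ) 1 := ⟨zero_le_one, le_rfl⟩
  have hzero : μ a = 0 := by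
    obtain ⟨γ, hγ0, hγm, hγ, hγ1⟩ := hflow a haI
    -- The curve from `a` returns to `a`, so by Rolle it meets a zero of the field and is therefore
    -- constant.
    obtain ⟨c, hc, e⟩ := exists_hasDerivAt_eq_zero (f := γ) (f' := fun t => μ (γ t)) zero_lt_one
      (fun t ht => (hγ t ht).continuousWithinAt) (by rw [hγ0, hγ1, (hfix a haI).2 rfl])
      (fun t ht => (hγ t (Ioo_subset_Icc_self ht)).hasDerivAt (Icc_mem_nhds ht.1 ht.2))
    have := integralCurve_const hd hcont hγm hγ (Ioo_subset_Icc_self hc) e 0 h01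
    rw [← hγ0, this]
    exact e
  have hne : ∀ x ∈ Ioo a b, ∀ γ : ℝ → ℝ, γ 0 = x → MapsTo γ (Icc 0 1) (Ico a b) →
      IsIntegralCurveOn γ (fun _ => μ) (Icc 0 1) → γ 1 = f x →
      ∀ t ∈ Icc (0 : ℝ) 1, μ (γ t) ≠ 0 := by
    intro x hx γ hγ0 hγm hγ hγ1 t ht e
    have h1 := integralCurve_const hd hcont hγm hγ ht e
    have h2 : f x = x := by rw [← hγ1, h1 1 h11, ← h1 0 h01, hγ0]
    exact hx.1.ne' ((hfix x (Ioo_subset_Ico_self hx)).1 h2)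
  have hnz : ∀ x ∈ Ioo a b, μ x ≠ 0 := by
    intro x hx
    obtain ⟨γ, hγ0, hγm, hγ, hγ1⟩ := hflow x (Ioo_subset_Ico_self hx)
    have := hne x hx γ hγ0 hγm hγ hγ1 0 h01
    rwa [hγ0] at this
  obtain ⟨T, hT⟩ := exists_primitive_on_Ioo (h := fun x => (μ x)⁻¹) hab
    ((hC1.continuousOn.mono Ioo_subset_Ico_self).inv₀ hnz)
  refine ⟨T, hd, hcont, hzero, hnz, hT, fun x hx => ?_⟩
  obtain ⟨γ, hγ0, hγm, hγ, hγ1⟩ := hflow x (Ioo_subset_Ico_self hx)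
  have hmem : ∀ t ∈ Icc (0 : ℝ) 1, γ t ∈ Ioo a b := by
    intro t ht
    refine ⟨lt_of_le_of_ne (hγm ht).1 fun e => ?_, (hγm ht).2⟩
    refine hne x hx γ hγ0 hγm hγ hγ1 t ht ?_
    rw [← e, hzero]
  have hTγ : ∀ t ∈ Icc (0 : ℝ) 1, HasDerivWithinAt (fun t => T (γ t)) 1 (Icc 0 1) t := by
    intro t ht
    refine ((hT _ (hmem t ht)).comp_hasDerivWithinAt t (hγ t ht)).congr_deriv ?_
    exact inv_mul_cancel₀ (hnz _ (hmem t ht))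
  obtain ⟨c, _, e⟩ := exists_hasDerivAt_eq_slope (fun t => T (γ t)) (fun _ => 1) zero_lt_one
    (fun t ht => (hTγ t ht).continuousWithinAt)
    (fun t ht => (hTγ t (Ioo_subset_Icc_self ht)).hasDerivAt (Icc_mem_nhds ht.1 ht.2))
  rw [hγ0, hγ1] at e
  linarith

/-! ### Diffeomorphisms close to the identity -/

/-- The distortion constant of a diffeomorphism that is `δ`-close to the identity. -/
noncomputable def distortionBound (δ : ℝ) : ℝ := δ / (1 - δ) ^ 2

/-- The bound on the logarithm of the derivative of such a diffeomorphism. -/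
noncomputable def logDerivBound (δ : ℝ) : ℝ := -Real.log (1 - δ)

/-- The bound on the derivative of its Szekeres field. -/
noncomputable def fieldDerivBound (δ : ℝ) : ℝ :=
  Real.exp (distortionBound δ + logDerivBound δ) *
    (δ / (1 - δ) + distortionBound δ * Real.exp (distortionBound δ))

/-- The bound on the logarithm of the ratio between its Szekeres field and its displacement. -/
noncomputable def logRatioBound (δ : ℝ) : ℝ := 2 * distortionBound δ + 2 * logDerivBound δ

section NearIdentity

variable {a b δ : ℝ} {f f' f'' g : ℝ → ℝ}

lemma exp_neg_logDerivBound (h1 : δ < 1) : Real.exp (-logDerivBound δ) = 1 - δ := by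
  rw [logDerivBound, neg_neg, Real.exp_log (by linarith)]

lemma exp_logDerivBound (h1 : δ < 1) : Real.exp (logDerivBound δ) = (1 - δ)⁻¹ := by
  rw [logDerivBound, Real.exp_neg, Real.exp_log (by linarith)]

lemma one_add_le_inv_one_sub (h1 : δ < 1) : 1 + δ ≤ (1 - δ)⁻¹ := by
  rw [← one_div, le_div_iff₀ (by linarith)]
  nlinarith [sq_nonneg δ]

lemma isContraction_of_near_id (hab : a < b) (hba : b - a ≤ 1) (h0 : 0 ≤ δ) (h1 : δ < 1)
    (hbij : BijOn f (Ico a b) (Ico a b)) (hfa : f a = a) (hlt : ∀ x ∈ Ioo a b, f x < x)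
    (hd : ∀ x ∈ Ico a b, HasDerivWithinAt f (f' x) (Ico a b) x)
    (hd2 : ∀ x ∈ Ico a b, HasDerivWithinAt f' (f'' x) (Ico a b) x)
    (hc : ContinuousOn f'' (Ico a b)) (hb : ∀ x ∈ Ico a b, |f' x - 1| ≤ δ)
    (hb2 : ∀ x ∈ Ico a b, |f'' x| ≤ δ) :
    IsContraction a b (distortionBound δ) (logDerivBound δ) (δ / (1 - δ)) f f' f'' where
  lt := hab
  sub_le := hba
  bijOn := hbij
  map_left := hfa
  map_lt := hlt
  deriv := hd
  deriv2 := hd2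
  cont := hc
  exp_le x hx := by
    rw [exp_neg_logDerivBound h1]
    linarith [(abs_le.1 (hb x hx)).1]
  le_exp x hx := by
    rw [exp_logDerivBound h1]
    linarith [(abs_le.1 (hb x hx)).2, one_add_le_inv_one_sub h1]
  abs_sub_one_le x hx := by
    refine (hb x hx).trans ?_
    rw [le_div_iff₀ (by linarith)]
    nlinarith
  abs_deriv2_le x hx := by
    have hp : 0 < 1 - δ := by linarith
    have h2 : 1 - δ ≤ f' x := by linarith [(abs_le.1 (hb x hx)).1]
    refine (hb2 x hx).trans ?_
    rw [distortionBound, div_mul_eq_mul_div, le_div_iff₀ (by positivity)]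
    refine mul_le_mul_of_nonneg_left ?_ h0
    nlinarith

/-- The inverse has `g' = 1 / f'` and `|g''| / g' = |f''| / f'^2` at the corresponding point. This
case dictates the square in `distortionBound` and the quotient `δ / (1 - δ)`. -/
lemma isContraction_inverse_of_near_id (hab : a < b) (hba : b - a ≤ 1) (h1 : δ < 1)
    (hbij : BijOn f (Ico a b) (Ico a b)) (hfa : f a = a) (hlt : ∀ x ∈ Ioo a b, x < f x)
    (hd : ∀ x ∈ Ico a b, HasDerivWithinAt f (f' x) (Ico a b) x)
    (hd2 : ∀ x ∈ Ico a b, HasDerivWithinAt f' (f'' x) (Ico a b) x)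
    (hc : ContinuousOn f'' (Ico a b)) (hb : ∀ x ∈ Ico a b, |f' x - 1| ≤ δ)
    (hb2 : ∀ x ∈ Ico a b, |f'' x| ≤ δ) (hgm : MapsTo g (Ico a b) (Ico a b))
    (hinv : InvOn g f (Ico a b) (Ico a b)) (hg : DifferentiableOn ℝ g (Ico a b)) :
    IsContraction a b (distortionBound δ) (logDerivBound δ) (δ / (1 - δ)) g
      (fun y => (f' (g y))⁻¹) (fun y => -(f'' (g y) * (f' (g y))⁻¹) / f' (g y) ^ 2) := by
  have hp : 0 < 1 - δ := by linarith
  have h0 : 0 ≤ δ := (abs_nonneg _).trans (hb a ⟨le_rfl, hab⟩)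
  have hlow : ∀ x ∈ Ico a b, 1 - δ ≤ f' x := fun x hx => by linarith [(abs_le.1 (hb x hx)).1]
  have hpos : ∀ x ∈ Ico a b, 0 < f' x := fun x hx => hp.trans_le (hlow x hx)
  have hga : g a = a := by
    have := hinv.1 (⟨le_rfl, hab⟩ : a ∈ Ico a b)
    rwa [hfa] at this
  have hgd : ∀ y ∈ Ico a b, HasDerivWithinAt g (f' (g y))⁻¹ (Ico a b) y := by
    intro y hy
    have h2 := (hg y hy).hasDerivWithinAt
    have h3 := (hd (g y) (hgm hy)).comp y h2 hgm
    have h4 : HasDerivWithinAt (f ∘ g) 1 (Ico a b) y :=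
      (hasDerivWithinAt_id y _).congr (fun z hz => hinv.2 hz) (hinv.2 hy)
    have h5 := (uniqueDiffOn_Ico a b y hy).eq_deriv _ h3 h4
    rwa [eq_inv_of_mul_eq_one_right h5] at h2
  have hgc : ContinuousOn g (Ico a b) := hg.continuousOn
  have hfc : ContinuousOn f' (Ico a b) := fun x hx => (hd2 x hx).continuousWithinAt
  refine ⟨hab, hba, ?_, hga, ?_, hgd, ?_, ?_, ?_, ?_, ?_, ?_⟩
  · exact ⟨hgm, hinv.2.injOn, fun x hx => ⟨f x, hbij.mapsTo hx, hinv.1 hx⟩⟩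
  · intro x hx
    have hxI := Ioo_subset_Ico_self hx
    have hgo : g x ∈ Ioo a b := by
      refine ⟨lt_of_le_of_ne (hgm hxI).1 fun e => hx.1.ne ?_, (hgm hxI).2⟩
      rw [← hinv.2 hxI, ← e, hfa]
    have := hlt _ hgo
    rwa [hinv.2 hxI] at this
  · exact fun y hy => ((hd2 _ (hgm hy)).comp y (hgd y hy) hgm).fun_inv (hpos _ (hgm hy)).ne'
  · exact (((hc.comp hgc hgm).mul
      ((hfc.comp hgc hgm).inv₀ fun y hy => (hpos _ (hgm hy)).ne')).neg).div
      ((hfc.comp hgc hgm).pow 2) fun y hy => (pow_pos (hpos _ (hgm hy)) 2).ne'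
  · intro y hy
    rw [exp_neg_logDerivBound h1, ← inv_inv (1 - δ)]
    refine inv_anti₀ (hpos _ (hgm hy)) ?_
    linarith [(abs_le.1 (hb _ (hgm hy))).2, one_add_le_inv_one_sub h1]
  · intro y hy
    rw [exp_logDerivBound h1]
    exact inv_anti₀ hp (hlow _ (hgm hy))
  · intro y hy
    have h2 := hpos _ (hgm hy)
    have h3 : (f' (g y))⁻¹ - 1 = -(f' (g y) - 1) / f' (g y) := by field_simp; ring
    rw [h3, abs_div, abs_neg, abs_of_pos h2]
    exact div_le_div₀ h0 (hb _ (hgm hy)) hp (hlow _ (hgm hy))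
  · intro y hy
    have h2 := hpos _ (hgm hy)
    have h3 : -(f'' (g y) * (f' (g y))⁻¹) / f' (g y) ^ 2 =
      -(f'' (g y) / f' (g y) ^ 2 * (f' (g y))⁻¹) := by ring
    rw [h3, abs_neg, abs_mul, abs_of_pos (inv_pos.2 h2), abs_div, abs_of_pos (pow_pos h2 2)]
    refine mul_le_mul_of_nonneg_right ?_ (inv_pos.2 h2).le
    exact div_le_div₀ h0 (hb2 _ (hgm hy)) (by positivity)
      (pow_le_pow_left₀ hp.le (hlow _ (hgm hy)) 2)

lemma BijOn.Ioo_of_Ico (hbij : BijOn f (Ico a b) (Ico a b)) (hfa : f a = a) (hab : a < b) :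
    BijOn f (Ioo a b) (Ioo a b) := by
  have haI : a ∈ Ico a b := ⟨le_rfl, hab⟩
  refine ⟨fun x hx => ?_, hbij.injOn.mono Ioo_subset_Ico_self, fun y hy => ?_⟩
  · have hxI := Ioo_subset_Ico_self hx
    refine ⟨lt_of_le_of_ne (hbij.mapsTo hxI).1 fun e => ?_, (hbij.mapsTo hxI).2⟩
    exact hx.1.ne (hbij.injOn haI hxI (hfa.trans e))
  · obtain ⟨x, hx, rfl⟩ := hbij.surjOn (Ioo_subset_Ico_self hy)
    refine ⟨x, ⟨lt_of_le_of_ne hx.1 fun e => ?_, hx.2⟩, rfl⟩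
    rw [← e, hfa] at hy
    exact hy.1.false

/-- The field with an Abel function of a diffeomorphism close to the identity: existence, bounds
and uniqueness. -/
lemma exists_abelPair_of_near_id (hab : a < b) (hba : b - a ≤ 1) (h0 : 0 ≤ δ) (h1 : δ < 1)
    (hbij : BijOn f (Ico a b) (Ico a b)) (hfix : ∀ x ∈ Ico a b, f x = x ↔ x = a)
    (hd : ∀ x ∈ Ico a b, HasDerivWithinAt f (f' x) (Ico a b) x)
    (hd2 : ∀ x ∈ Ico a b, HasDerivWithinAt f' (f'' x) (Ico a b) x)
    (hc : ContinuousOn f'' (Ico a b)) (hb : ∀ x ∈ Ico a b, |f' x - 1| ≤ δ)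
    (hb2 : ∀ x ∈ Ico a b, |f'' x| ≤ δ) (hgm : MapsTo g (Ico a b) (Ico a b))
    (hinv : InvOn g f (Ico a b) (Ico a b)) (hg : DifferentiableOn ℝ g (Ico a b)) :
    ∃ ν ν' T : ℝ → ℝ, AbelPair a b f ν ν' T ∧
      (∀ x ∈ Ioo a b, Real.exp (-logRatioBound δ) ≤ ν x / (f x - x) ∧
        ν x / (f x - x) ≤ Real.exp (logRatioBound δ)) ∧
      (∀ x ∈ Ico a b, |ν' x| ≤ fieldDerivBound δ) ∧
      ∀ μ μ' M : ℝ → ℝ, AbelPair a b f μ μ' M → EqOn μ ν (Ico a b) := by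
  have hfa : f a = a := (hfix a ⟨le_rfl, hab⟩).2 rfl
  have hfc : ContinuousOn f (Ico a b) := fun x hx => (hd x hx).continuousWithinAt
  have hlow {φ φ' φ'' ν : ℝ → ℝ} {K L η : ℝ} (h : IsContraction a b K L η φ φ' φ'')
      (hr : ∀ x ∈ Ioo a b, Real.exp (-(2 * K + L)) ≤ ν x / (φ x - x)) :
      ∀ x ∈ Ioo a b, Real.exp (-(2 * K + L)) * (x - φ x) ≤ |ν x| := by
    intro x hx
    have h2 := sub_pos.2 (h.map_lt x hx)
    have h3 := hr x hx
    rw [← neg_sub x, div_neg, ← neg_div, le_div_iff₀ h2] at h3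
    exact h3.trans (neg_le_abs _)
  rcases pos_or_neg_of_ne_zero (h := fun x => f x - x)
    ((hfc.sub continuousOn_id).mono Ioo_subset_Ico_self)
    (fun x hx e => hx.1.ne' ((hfix x (Ioo_subset_Ico_self hx)).1 (sub_eq_zero.1 e))) with hs | hs
  · have h := isContraction_inverse_of_near_id hab hba h1 hbij hfa (fun x hx => sub_pos.1 (hs x hx))
      hd hd2 hc hb hb2 hgm hinv hg
    have hIoo := BijOn.Ioo_of_Ico hbij hfa hab
    obtain ⟨ν, ν', T, hA, hr, hν'⟩ := h.exists_abelPair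
    refine ⟨_, _, _, hA.inverse hIoo.mapsTo fun x hx => hinv.1 (Ioo_subset_Ico_self hx),
      fun x hx => ?_, fun x hx => ?_, fun μ μ' M hM => ?_⟩
    · have hfx := hIoo.mapsTo hx
      have hgf : g (f x) = x := hinv.1 (Ioo_subset_Ico_self hx)
      have hgx := h.mapsTo_Ioo hx
      -- The displacement of `f` at `x` is that of `g` at `f x`, up to sign. Comparing it with that
      -- of `g` at `x` costs one more `exp L`, hence the coefficient `2` of `logDerivBound` in
      -- `logRatioBound`.
      obtain ⟨h2, h3⟩ := h.displacement_ratio hfx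
        (y := x) ⟨hgf.le, (sub_pos.1 (hs x hx)).le⟩
      rw [hgf] at h2 h3
      obtain ⟨h4, h5⟩ := hr x hx
      have hp : 0 < f x - x := hs x hx
      have hq : 0 < x - g x := sub_pos.2 (h.map_lt x hx)
      have e1 : -ν x / (f x - x) = ν x / (g x - x) * ((x - g x) / (f x - x)) := by
        have : g x - x ≠ 0 := by linarith
        field_simp
        ring
      have e2 : -logRatioBound δ =
          -(2 * distortionBound δ + logDerivBound δ) + -logDerivBound δ := by
        rw [logRatioBound]; ring
      have e3 : logRatioBound δ = 2 * distortionBound δ + logDerivBound δ + logDerivBound δ := by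
        rw [logRatioBound]; ring
      rw [e1, e2, Real.exp_add, e3, Real.exp_add]
      rw [← le_div_iff₀ hp] at h2
      rw [← div_le_iff₀ hp] at h3
      exact ⟨mul_le_mul h4 h2 (Real.exp_pos _).le ((Real.exp_pos _).le.trans h4),
        mul_le_mul h5 h3 (by positivity) (Real.exp_pos _).le⟩
    · rw [abs_neg]
      exact hν' x hx
    · have hM' := hM.inverse h.mapsTo_Ioo fun x hx => hinv.2 (Ioo_subset_Ico_self hx)
      intro x hx
      exact neg_eq_iff_eq_neg.1
        (h.abelPair_unique (Real.exp_pos _) (hlow h fun x hx => (hr x hx).1) hA hM' hx)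
  · have h := isContraction_of_near_id hab hba h0 h1 hbij hfa (fun x hx => sub_neg.1 (hs x hx))
      hd hd2 hc hb hb2
    obtain ⟨ν, ν', T, hA, hr, hν'⟩ := h.exists_abelPair
    have hL := h.L_nonneg
    refine ⟨ν, ν', T, hA, fun x hx => ?_, hν', fun μ μ' M hM =>
      h.abelPair_unique (Real.exp_pos _) (hlow h fun x hx => (hr x hx).1) hA hM⟩
    exact ⟨(Real.exp_le_exp.2 (by rw [logRatioBound]; linarith)).trans (hr x hx).1,
      (hr x hx).2.trans (Real.exp_le_exp.2 (by rw [logRatioBound]; linarith))⟩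

end NearIdentity

/-! ### Passing between the norms and pointwise bounds. -/

lemma abs_iteratedDerivWithin_le_of_ckNorm_lt {k m : ℕ} {I : Set ℝ} {h : ℝ → ℝ} {δ x : ℝ}
    (hk : ckNorm k I h < ENNReal.ofReal δ) (hm : m ≤ k) (hx : x ∈ I) :
    |iteratedDerivWithin m h I x| ≤ δ := by
  have h1 : ‖iteratedDerivWithin m h I x‖ₑ ≤ ckNorm k I h :=
    (le_iSup₂ (f := fun x (_ : x ∈ I) => ‖iteratedDerivWithin m h I x‖ₑ) x hx).trans
      (le_iSup₂ (f := fun m (_ : m ∈ Iic k) => ⨆ x ∈ I, ‖iteratedDerivWithin m h I x‖ₑ) m hm)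
  have h2 := h1.trans_lt hk
  rw [Real.enorm_eq_ofReal_abs] at h2
  exact ((ENNReal.ofReal_lt_ofReal_iff').1 h2).1.le

lemma ckNorm_one_le {a b C : ℝ} {h h' : ℝ → ℝ}
    (hd : ∀ x ∈ Ico a b, HasDerivWithinAt h (h' x) (Ico a b) x)
    (h0 : ∀ x ∈ Ico a b, |h x| ≤ C) (h1 : ∀ x ∈ Ico a b, |h' x| ≤ C) :
    ckNorm 1 (Ico a b) h ≤ ENNReal.ofReal C := by
  refine iSup₂_le fun m hm => iSup₂_le fun x hx => ?_
  rw [Real.enorm_eq_ofReal_abs]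
  refine ENNReal.ofReal_le_ofReal ?_
  have hm' : m = 0 ∨ m = 1 := by
    have : m ≤ 1 := hm
    omega
  rcases hm' with rfl | rfl
  · rw [iteratedDerivWithin_zero]
    exact h0 x hx
  · rw [iteratedDerivWithin_one, (hd x hx).derivWithin (uniqueDiffOn_Ico a b x hx)]
    exact h1 x hx

/-- The `C^2` data of a diffeomorphism and the bounds given by its distance to the identity. -/
lemma IsDiffeoOn.deriv_bounds {r : ℕ∞} {a b δ : ℝ} {f : ℝ → ℝ} (hr : 2 ≤ r)
    (hf : IsDiffeoOn r (Ico a b) f)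
    (hn : ckNorm 2 (Ico a b) (fun x => f x - x) < ENNReal.ofReal δ) :
    ∃ f' f'' : ℝ → ℝ, (∀ x ∈ Ico a b, HasDerivWithinAt f (f' x) (Ico a b) x) ∧
      (∀ x ∈ Ico a b, HasDerivWithinAt f' (f'' x) (Ico a b) x) ∧ ContinuousOn f'' (Ico a b) ∧
      (∀ x ∈ Ico a b, |f x - x| ≤ δ) ∧ (∀ x ∈ Ico a b, |f' x - 1| ≤ δ) ∧
      ∀ x ∈ Ico a b, |f'' x| ≤ δ := by
  have hu := uniqueDiffOn_Ico a b
  have h2 : ContDiffOn ℝ (1 + 1) f (Ico a b) := by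
    refine hf.2.1.of_le ?_
    rw [one_add_one_eq_two]
    exact WithTop.coe_le_coe.2 hr
  obtain ⟨hd, -, hC1⟩ := (contDiffOn_succ_iff_derivWithin hu).1 h2
  obtain ⟨hd', hc⟩ := (contDiffOn_one_iff_derivWithin hu).1 hC1
  have e1 : EqOn (iteratedDerivWithin 1 (fun x => f x - x) (Ico a b))
      (fun x => derivWithin f (Ico a b) x - 1) (Ico a b) := fun x hx => by
    rw [iteratedDerivWithin_one]
    exact ((hd x hx).hasDerivWithinAt.sub (hasDerivWithinAt_id x _)).derivWithin (hu x hx)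
  refine ⟨derivWithin f (Ico a b), derivWithin (derivWithin f (Ico a b)) (Ico a b),
    fun x hx => (hd x hx).hasDerivWithinAt, fun x hx => (hd' x hx).hasDerivWithinAt, hc,
    fun x hx => ?_, fun x hx => ?_, fun x hx => ?_⟩
  · simpa using abs_iteratedDerivWithin_le_of_ckNorm_lt hn (Nat.zero_le 2) hx
  · have := abs_iteratedDerivWithin_le_of_ckNorm_lt hn one_le_two hx
    rwa [e1 hx] at this
  · have := abs_iteratedDerivWithin_le_of_ckNorm_lt hn le_rfl hx
    rwa [iteratedDerivWithin_succ, derivWithin_congr e1 (e1 hx), derivWithin_sub_const] at this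

lemma isFlowOn_congr {a b : ℝ} {μ ν : ℝ → ℝ} (h : EqOn μ ν (Ico a b))
    {φ : ℝ → ℝ → ℝ} : IsFlowOn (Ico a b) μ φ ↔ IsFlowOn (Ico a b) ν φ := by
  refine forall₂_congr fun x _ => and_congr_right fun _ => and_congr_right fun hm =>
    forall_congr' fun t => ?_
  simp only [h (hm t)]

/-! ### Sign, continuity and value at zero of the explicit bounds. -/

lemma logRatioBound_nonneg {δ : ℝ} (h0 : 0 ≤ δ) (h1 : δ < 1) : 0 ≤ logRatioBound δ := by
  have h2 : 0 ≤ distortionBound δ := div_nonneg h0 (sq_nonneg _)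
  have h3 : Real.log (1 - δ) ≤ 0 := Real.log_nonpos (by linarith) (by linarith)
  rw [logRatioBound, logDerivBound]
  linarith

lemma fieldDerivBound_nonneg {δ : ℝ} (h0 : 0 ≤ δ) (h1 : δ < 1) : 0 ≤ fieldDerivBound δ := by
  have h2 : 0 ≤ distortionBound δ := div_nonneg h0 (sq_nonneg _)
  have h3 : 0 ≤ δ / (1 - δ) := div_nonneg h0 (by linarith)
  rw [fieldDerivBound]
  positivity

lemma continuousOn_distortionBound : ContinuousOn distortionBound (Ico 0 1) := by
  refine continuousOn_id.div (by fun_prop) fun x hx => ?_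
  have : 0 < 1 - x := sub_pos.2 hx.2
  positivity

lemma continuousOn_logDerivBound : ContinuousOn logDerivBound (Ico 0 1) :=
  ((continuousOn_const.sub continuousOn_id).log fun _ hx => (sub_pos.2 hx.2).ne').neg

lemma continuousOn_logRatioBound : ContinuousOn logRatioBound (Ico 0 1) :=
  (continuousOn_distortionBound.const_mul 2).add (continuousOn_logDerivBound.const_mul 2)

lemma continuousOn_fieldDerivBound : ContinuousOn fieldDerivBound (Ico 0 1) := by
  have h1 := continuousOn_distortionBound
  refine (h1.add continuousOn_logDerivBound).rexp.mul (ContinuousOn.add ?_ (h1.mul h1.rexp))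
  exact continuousOn_id.div (by fun_prop) fun x hx => (sub_pos.2 hx.2).ne'

lemma logRatioBound_zero : logRatioBound 0 = 0 := by
  simp [logRatioBound, distortionBound, logDerivBound]

lemma fieldDerivBound_zero : fieldDerivBound 0 = 0 := by
  simp [fieldDerivBound, distortionBound]

/-- The bound on the Szekeres field and its derivative. -/
noncomputable def fieldBound (δ : ℝ) : ℝ := logRatioBound δ + fieldDerivBound δ + δ

/-- The bound on the flow. -/
noncomputable def flowBound (δ : ℝ) : ℝ :=
  Real.exp (logRatioBound δ) * δ + fieldDerivBound δ * Real.exp (fieldDerivBound δ) + δ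

end Szekeres

/-! ### The main theorem. -/

open Szekeres in
theorem lemmal :
    ∃ u v : ℝ → ℝ,
      ContinuousOn u (Ico 0 1) ∧ u 0 = 0 ∧ ContinuousOn v (Ico 0 1) ∧ v 0 = 0 ∧
      ∀ (r : ℕ∞) (a b δ : ℝ) (f : ℝ → ℝ),
        2 ≤ r → 0 ≤ a → a < b → b ≤ 1 →
        Szekeres.IsDiffeoOn r (Ico a b) f →
        (∀ x ∈ Ico a b, f x = x ↔ x = a) →
        Szekeres.ckNorm 2 (Ico a b) (fun x => f x - x) < ENNReal.ofReal δ → δ < 1 →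
        -- the Szekeres vector field of `f` exists and is unique on `[a, b)`
        (∃ ν, Szekeres.IsSzekeresField a b f ν ∧
          ∀ μ, Szekeres.IsSzekeresField a b f μ → EqOn μ ν (Ico a b)) ∧
        ∀ ν, Szekeres.IsSzekeresField a b f ν →
          -- the two bounds on the vector field
          (∀ x ∈ Ioo a b, 0 < ν x / (f x - x)) ∧
          (⨆ x ∈ Ioo a b, ‖Real.log (ν x / (f x - x))‖ₑ) < ENNReal.ofReal (u δ) ∧
          (⨆ x ∈ Ico a b, ‖derivWithin ν (Ico a b) x‖ₑ) < ENNReal.ofReal (u δ) ∧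
          -- the bound on its flow
          (∃ φ, Szekeres.IsFlowOn (Ico a b) ν φ) ∧
          ∀ φ, Szekeres.IsFlowOn (Ico a b) ν φ →
            EqOn (φ 1) f (Ico a b) ∧
            ∀ t ∈ Icc (0 : ℝ) 1,
              ContDiffOn ℝ 1 (φ t) (Ico a b) ∧
              Szekeres.ckNorm 1 (Ico a b) (fun x => φ t x - x) ≤ ENNReal.ofReal (t * v δ) ∧
              (0 < t →
                Szekeres.ckNorm 1 (Ico a b) (fun x => φ t x - x) < ENNReal.ofReal (t * v δ)) := by
  refine ⟨fieldBound, flowBound,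
    (continuousOn_logRatioBound.add continuousOn_fieldDerivBound).add continuousOn_id,
    by simp [fieldBound, logRatioBound_zero, fieldDerivBound_zero],
    ((continuousOn_logRatioBound.rexp.mul continuousOn_id).add
      (continuousOn_fieldDerivBound.mul continuousOn_fieldDerivBound.rexp)).add continuousOn_id,
    by simp [flowBound, fieldDerivBound_zero], ?_⟩
  intro r a b δ f hr ha hab hb hf hfix hn h1
  have hδ : 0 < δ := ENNReal.ofReal_pos.1 (bot_le.trans_lt hn)
  have hu := uniqueDiffOn_Ico a b
  obtain ⟨f', f'', hd, hd2, hc, hb0, hb1, hb2⟩ := hf.deriv_bounds hr hn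
  obtain ⟨hfm, -, g, hgm, hgC, hinv⟩ := hf
  have hbij : BijOn f (Ico a b) (Ico a b) := hinv.bijOn hfm hgm
  have hfa : f a = a := (hfix a ⟨le_rfl, hab⟩).2 rfl
  have hIoo := BijOn.Ioo_of_Ico hbij hfa hab
  obtain ⟨ν, ν', T, hA, hratio, hν', huniq⟩ := exists_abelPair_of_near_id hab (by linarith) hδ.le
    h1 hbij hfix hd hd2 hc hb1 hb2 hgm hinv
    (hgC.differentiableOn (by
      have : r ≠ 0 := fun e => by simp [e] at hr
      exact_mod_cast this))
  obtain ⟨ψ, hψ, hψ1, hψ'⟩ := hA.exists_flow hab hIoo hfa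
  have hLip := lipschitzOnWith_of_abs_deriv_le (convex_Ico a b) hA.deriv hν'
  have hR := logRatioBound_nonneg hδ.le h1
  have hD := fieldDerivBound_nonneg hδ.le h1
  have hSz : ∀ μ, IsSzekeresField a b f μ → EqOn μ ν (Ico a b) := fun μ hμ => by
    obtain ⟨M, hM⟩ := hμ.exists_abelPair hab hfix
    exact huniq _ _ _ hM
  have hνabs : ∀ x ∈ Ico a b, |ν x| ≤ Real.exp (logRatioBound δ) * δ := by
    intro x hx
    rcases hx.1.eq_or_lt with rfl | hlt
    · rw [hA.zero, abs_zero]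
      positivity
    · have hxo : x ∈ Ioo a b := ⟨hlt, hx.2⟩
      have hne : f x - x ≠ 0 := sub_ne_zero.2 fun e => hlt.ne' ((hfix x hx).1 e)
      obtain ⟨h2, h3⟩ := hratio x hxo
      rw [← div_mul_cancel₀ (ν x) hne, abs_mul, abs_of_pos ((Real.exp_pos _).trans_le h2)]
      exact mul_le_mul h3 (hb0 x hx) (abs_nonneg _) (Real.exp_pos _).le
  refine ⟨⟨ν, ⟨?_, fun x hx => ⟨fun t => ψ t x, (hψ x hx).1, fun t _ => (hψ x hx).2.1 t,
    (hψ x hx).2.2.isIntegralCurveOn _, hψ1 hx⟩⟩, hSz⟩, ?_⟩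
  · rw [contDiffOn_one_iff_derivWithin hu]
    exact ⟨fun x hx => (hA.deriv x hx).differentiableWithinAt,
      hA.cont.congr fun x hx => (hA.deriv x hx).derivWithin (hu x hx)⟩
  intro μ hμ
  have hEq := hSz μ hμ
  refine ⟨fun x hx => ?_, ?_, ?_, ?_, ?_⟩
  · rw [hEq (Ioo_subset_Ico_self hx)]
    exact (Real.exp_pos _).trans_le (hratio x hx).1
  -- Strictness comes from the summand `δ > 0` of `fieldBound`; the other two are nonnegative, so
  -- one function serves both suprema.
  · refine lt_of_le_of_lt (b := ENNReal.ofReal (logRatioBound δ)) (iSup₂_le fun x hx => ?_) ?_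
    · rw [hEq (Ioo_subset_Ico_self hx), Real.enorm_eq_ofReal_abs]
      exact ENNReal.ofReal_le_ofReal
        ((abs_log_le_iff ((Real.exp_pos _).trans_le (hratio x hx).1)).2 (hratio x hx))
    · rw [ENNReal.ofReal_lt_ofReal_iff', fieldBound]
      constructor <;> linarith
  · refine lt_of_le_of_lt (b := ENNReal.ofReal (fieldDerivBound δ)) (iSup₂_le fun x hx => ?_) ?_
    · rw [derivWithin_congr hEq (hEq hx), (hA.deriv x hx).derivWithin (hu x hx),
        Real.enorm_eq_ofReal_abs]
      exact ENNReal.ofReal_le_ofReal (hν' x hx)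
    · rw [ENNReal.ofReal_lt_ofReal_iff', fieldBound]
      constructor <;> linarith
  · exact ⟨ψ, (isFlowOn_congr hEq).2 hψ⟩
  · intro φ hφ
    have hφψ := IsFlowOn.unique hLip ((isFlowOn_congr hEq).1 hφ) hψ
    refine ⟨fun x hx => (hφψ 1 hx).trans (hψ1 hx), fun t ht => ?_⟩
    obtain ⟨D, hDc, hDd⟩ := hA.flow_hasDerivWithinAt hab hν' hψ hψ' ht
    have hφd : ∀ x ∈ Ico a b, HasDerivWithinAt (φ t) (D x) (Ico a b) x := fun x hx =>
      (hDd x hx).1.congr (hφψ t) (hφψ t hx)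
    have hE : 0 ≤ Real.exp (logRatioBound δ) * δ := by positivity
    have hE' : 0 ≤ fieldDerivBound δ * Real.exp (fieldDerivBound δ) := by positivity
    -- Without its last summand `δ`, `flowBound` already bounds the norm; that summand gives
    -- strictness for `t > 0`.
    have hck : ckNorm 1 (Ico a b) (fun x => φ t x - x) ≤
        ENNReal.ofReal (t * (flowBound δ - δ)) := by
      refine ckNorm_one_le (h' := fun x => D x - 1)
        (fun x hx => (hφd x hx).sub (hasDerivWithinAt_id x _)) (fun x hx => ?_) fun x hx => ?_
      · rw [hφψ t hx]
        refine (hψ.abs_sub_le hνabs ht.1 hx).trans (mul_le_mul_of_nonneg_left ?_ ht.1)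
        rw [flowBound]
        linarith
      · refine (hDd x hx).2.trans (mul_le_mul_of_nonneg_left ?_ ht.1)
        rw [flowBound]
        linarith
    have hlt : 0 < t →
        ENNReal.ofReal (t * (flowBound δ - δ)) < ENNReal.ofReal (t * flowBound δ) := by
      intro htp
      have : 0 < flowBound δ := by rw [flowBound]; linarith
      exact (ENNReal.ofReal_lt_ofReal_iff (mul_pos htp this)).2
        (mul_lt_mul_of_pos_left (by linarith) htp)
    refine ⟨?_, hck.trans (ENNReal.ofReal_le_ofReal
      (mul_le_mul_of_nonneg_left (by linarith) ht.1)), fun htp => hck.trans_lt (hlt htp)⟩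
    rw [contDiffOn_one_iff_derivWithin hu]
    exact ⟨fun x hx => (hφd x hx).differentiableWithinAt,
      hDc.congr fun x hx => (hφd x hx).derivWithin (hu x hx)⟩
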